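/- **Theorem.** Let $k$ be a field and let $(\mathcal C,\otimes,1)$ be a small $k$-linear symmetric monoidal category ($\mathcal C$ is enriched in $k$-vector spaces and $\otimes$ is $k$-bilinear on morphisms). Let $\mathrm{Mod}_k(\mathcal C)$ be the category of $k$-linear functors $\mathcal C^{op}\to \mathrm{Mod}_k$, with the symmetric monoidal structure given by the Day convolution product $$(F\otimes^{Day} G)(U)=\int^{X,Y}\mathcal C(U,X\otimes Y)\otimes_k F(X)\otimes_k G(Y),$$ whose unit is $\mathcal C(-,1)$. Let $\mathrm{coCAlg}^{Day}_k(\mathcal C)$ be the category of coassociative, counital, cocommutative coalgebra objects in $(\mathrm{Mod}_k(\mathcal C),\otimes^{Day})$. For a presheaf $F$ let $\#(F)$ be the cardinality of $\coprod_{X\in \mathrm{Ob}\,\mathcal C}F(X)$, and let $\#(\mathcal C)$ be the cardinality of the set of all morphisms of $\mathcal C$. Then: 1. The category $\mathrm{coCAlg}^{Day}_k(\mathcal C)$ is locally presentable. 2. The coalgebras $F$ with $\#(F)\le\max(\#(\mathcal C),\aleph_0)$ form, up to isomorphism, a set, and they are a strong generator of $\mathrm{coCAlg}^{Day}_k(\mathcal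 C)$: if $f\neq g\colon A\to B$ are morphisms of coalgebras, there is a morphism $h\colon F\to A$ from such a coalgebra $F$ with $fh\ne gh$; and for every proper subobject $L$ of a coalgebra $K$ there is a morphism $F\to K$ from such a coalgebra $F$ which does not factor through $L$. 3. The underlying functor $U\colon \mathrm{coCAlg}^{Day}_k(\mathcal C)\to \mathrm{Mod}_k(\mathcal C)$ has a right adjoint and is comonadic. (For instance, $\mathcal C$ may be a small model of Voevodsky's category of finite correspondences between smooth schemes over a field, with coefficients in $k$; then $\mathrm{Mod}_k(\mathcal C)$ is the category of presheaves with transfers with coefficients in $k$.) -/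

import Mathlib

open CategoryTheory MonoidalCategory Opposite
open scoped TensorProduct DirectSum

universe u

noncomputable section

set_option linter.unusedSectionVars false

namespace DayCoalg

section Presheaves

variable (k : Type u) [Field k] (C : Type u) [SmallCategory C] [Preadditive C] [Linear k C]

/-- The `k`-linear functors among the presheaves of `k`-vector spaces on a `k`-linear category. -/
structure IsLinearPresheaf (F : Cᵒᵖ ⥤ ModuleCat.{u} k) : Prop where
  map_add : ∀ {X Y : C} (f g : X ⟶ Y), F.map (f + g).op = F.map f.op + F.map g.op
  map_smul : ∀ {X Y : C} (r : k) (f : X ⟶ Y), F.map (r • f).op = r • F.map f.op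

/-- `Mod_k(C)`: the category of `k`-linear presheaves of `k`-vector spaces on `C`, with all natural
transformations as morphisms. -/
abbrev LinPsh : Type (u + 1) :=
  ObjectProperty.FullSubcategory (fun F : Cᵒᵖ ⥤ ModuleCat.{u} k => IsLinearPresheaf k C F)

end Presheaves

section Elements

variable {k : Type u} [Field k] {C : Type u} [SmallCategory C] [Preadditive C] [Linear k C]

/-- The vector space of sections `F(X)`. -/
abbrev Sec (F : LinPsh k C) (X : C) : Type u := F.obj.obj (op X)

/-- The restriction map `f^* : F(Y) → F(X)` along `f : X ⟶ Y`. -/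
def res (F : LinPsh k C) {X Y : C} (f : X ⟶ Y) : Sec F Y →ₗ[k] Sec F X := (F.obj.map f.op).hom

/-- The component `F(X) → G(X)` of a morphism of presheaves. -/
def app {F G : LinPsh k C} (η : F ⟶ G) (X : C) : Sec F X →ₗ[k] Sec G X := (η.hom.app (op X)).hom

@[simp] lemma res_id (F : LinPsh k C) (X : C) (s : Sec F X) : res F (𝟙 X) s = s := by
  simp [res]

lemma res_comp (F : LinPsh k C) {X Y Z : C} (f : X ⟶ Y) (g : Y ⟶ Z) (s : Sec F Z) :
    res F (f ≫ g) s = res F f (res F g s) := by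
  simp [res]

lemma res_add (F : LinPsh k C) {X Y : C} (f g : X ⟶ Y) (s : Sec F Y) :
    res F (f + g) s = res F f s + res F g s := by
  rw [res, F.property.map_add]
  rfl

lemma res_smul (F : LinPsh k C) {X Y : C} (r : k) (f : X ⟶ Y) (s : Sec F Y) :
    res F (r • f) s = r • res F f s := by
  rw [res, F.property.map_smul]
  rfl

lemma app_res {F G : LinPsh k C} (η : F ⟶ G) {X Y : C} (f : X ⟶ Y) (s : Sec F Y) :
    app η X (res F f s) = res G f (app η Y s) := by
  have := η.hom.naturality f.op
  exact congrArg (fun h => h.hom s) this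

@[simp] lemma app_id (F : LinPsh k C) (X : C) (s : Sec F X) : app (𝟙 F) X s = s := rfl

@[simp] lemma app_comp {F G H : LinPsh k C} (η : F ⟶ G) (θ : G ⟶ H) (X : C) (s : Sec F X) :
    app (η ≫ θ) X s = app θ X (app η X s) := rfl

lemma psh_hom_ext {F G : LinPsh k C} {η θ : F ⟶ G}
    (h : ∀ (X : C) (s : Sec F X), app η X s = app θ X s) : η = θ := by
  apply ObjectProperty.hom_ext
  ext X s
  exact h X.unop s

/-- A linear presheaf from its sections and restriction maps. -/
def mkPsh (S : C → Type u) [∀ X, AddCommGroup (S X)] [∀ X, Module k (S X)]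
    (r : ∀ {X Y : C}, (X ⟶ Y) → S Y →ₗ[k] S X)
    (r_id : ∀ (X : C) (s : S X), r (𝟙 X) s = s)
    (r_comp : ∀ {X Y Z : C} (f : X ⟶ Y) (g : Y ⟶ Z) (s : S Z), r (f ≫ g) s = r f (r g s))
    (r_add : ∀ {X Y : C} (f g : X ⟶ Y) (s : S Y), r (f + g) s = r f s + r g s)
    (r_smul : ∀ {X Y : C} (c : k) (f : X ⟶ Y) (s : S Y), r (c • f) s = c • r f s) :
    LinPsh k C where
  obj :=
    { obj := fun X => ModuleCat.of k (S X.unop)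
      map := fun f => ModuleCat.ofHom (r f.unop)
      map_id := fun X => by ext s; exact r_id _ s
      map_comp := fun f g => by ext s; exact r_comp _ _ s }
  property :=
    { map_add := fun f g => by ext s; exact r_add _ _ s
      map_smul := fun c f => by ext s; exact r_smul _ _ s }

/-- A morphism of linear presheaves from its components. -/
def mkHom {F G : LinPsh k C} (a : ∀ X : C, Sec F X →ₗ[k] Sec G X)
    (nat : ∀ {X Y : C} (f : X ⟶ Y) (s : Sec F Y), a X (res F f s) = res G f (a Y s)) : F ⟶ G :=
  ObjectProperty.homMk
    { app := fun X => ModuleCat.ofHom (a X.unop)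
      naturality := fun X Y f => by ext s; exact nat f.unop s }

@[simp] lemma app_mkHom {F G : LinPsh k C} (a : ∀ X : C, Sec F X →ₗ[k] Sec G X)
    (nat : ∀ {X Y : C} (f : X ⟶ Y) (s : Sec F Y), a X (res F f s) = res G f (a Y s)) (X : C) :
    app (mkHom a nat) X = a X := rfl

variable (k) in
/-- The presheaf `C(-, A)` represented by an object `A`. -/
def rep (A : C) : LinPsh k C where
  obj := (linearYoneda k C).obj A
  property :=
    { map_add := fun f g => by ext s; exact Preadditive.add_comp _ _ _ f g s
      map_smul := fun c f => by ext s; exact Linear.smul_comp _ _ _ c f s }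

end Elements

section Day

variable {k : Type u} [Field k] {C : Type u} [SmallCategory C] [Preadditive C] [Linear k C]
  [MonoidalCategory C]

/-- The direct sum over all pairs `(X, Y)` of `C(U, X ⊗ Y) ⊗ F(X) ⊗ G(Y)`. -/
abbrev DaySum (F G : LinPsh k C) (U : C) : Type u :=
  ⨁ p : C × C, (U ⟶ p.1 ⊗ p.2) ⊗[k] (Sec F p.1 ⊗[k] Sec G p.2)

open scoped Classical in
/-- The element `φ ⊗ (s ⊗ t)` of the summand of index `(X, Y)`. -/
def pureTensor (F G : LinPsh k C) {U X Y : C} (φ : U ⟶ X ⊗ Y) (s : Sec F X) (t : Sec G Y) :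
    DaySum F G U :=
  DirectSum.lof k (C × C)
    (fun p => (U ⟶ p.1 ⊗ p.2) ⊗[k] (Sec F p.1 ⊗[k] Sec G p.2)) (X, Y) (φ ⊗ₜ[k] (s ⊗ₜ[k] t))

/-- The coend relations
`(φ ≫ (α ⊗ β)) ⊗ (s ⊗ t) ∼ φ ⊗ (α^* s ⊗ β^* t)` for `φ : U ⟶ X' ⊗ Y'`, `α : X' ⟶ X`,
`β : Y' ⟶ Y`, `s ∈ F(X)` and `t ∈ G(Y)`. -/
def dayRel (F G : LinPsh k C) (U : C) : Submodule k (DaySum F G U) :=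
  Submodule.span k {z | ∃ (X Y X' Y' : C) (φ : U ⟶ X' ⊗ Y') (α : X' ⟶ X) (β : Y' ⟶ Y)
    (s : Sec F X) (t : Sec G Y),
    z = pureTensor F G (φ ≫ (α ⊗ₘ β)) s t - pureTensor F G φ (res F α s) (res G β t)}

/-- The sections over `U` of the Day convolution product, that is, the coend
`∫^{X, Y} C(U, X ⊗ Y) ⊗ F(X) ⊗ G(Y)` of vector spaces. -/
def DaySec (F G : LinPsh k C) (U : C) : Type u := DaySum F G U ⧸ dayRel F G U

instance (F G : LinPsh k C) (U : C) : AddCommGroup (DaySec F G U) :=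
  inferInstanceAs (AddCommGroup (DaySum F G U ⧸ dayRel F G U))

instance (F G : LinPsh k C) (U : C) : Module k (DaySec F G U) :=
  inferInstanceAs (Module k (DaySum F G U ⧸ dayRel F G U))

/-- The quotient map onto the sections of the Day convolution product. -/
def dayQ (F G : LinPsh k C) (U : C) : DaySum F G U →ₗ[k] DaySec F G U := (dayRel F G U).mkQ

/-- The class of `φ ⊗ (s ⊗ t)` in the Day convolution product. -/
def mk {F G : LinPsh k C} {U X Y : C} (φ : U ⟶ X ⊗ Y) (s : Sec F X) (t : Sec G Y) :
    DaySec F G U := dayQ F G U (pureTensor F G φ s t)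

lemma mk_rel {F G : LinPsh k C} {U X Y X' Y' : C} (φ : U ⟶ X' ⊗ Y') (α : X' ⟶ X) (β : Y' ⟶ Y)
    (s : Sec F X) (t : Sec G Y) :
    mk (φ ≫ (α ⊗ₘ β)) s t = mk φ (res F α s) (res G β t) := by
  rw [mk, mk, ← sub_eq_zero, ← map_sub]
  refine (Submodule.Quotient.mk_eq_zero (dayRel F G U)).2 ?_
  exact Submodule.subset_span ⟨X, Y, X', Y', φ, α, β, s, t, rfl⟩

section MkLinear

variable {F G : LinPsh k C} {U X Y : C}

lemma mk_add_hom (φ ψ : U ⟶ X ⊗ Y) (s : Sec F X) (t : Sec G Y) :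
    mk (φ + ψ) s t = mk φ s t + mk ψ s t := by
  simp [mk, pureTensor, TensorProduct.add_tmul]

lemma mk_smul_hom (c : k) (φ : U ⟶ X ⊗ Y) (s : Sec F X) (t : Sec G Y) :
    mk (c • φ) s t = c • mk φ s t := by
  rw [mk, pureTensor, ← TensorProduct.smul_tmul', map_smul, map_smul, mk, pureTensor]

lemma mk_add_left (φ : U ⟶ X ⊗ Y) (s s' : Sec F X) (t : Sec G Y) :
    mk φ (s + s') t = mk φ s t + mk φ s' t := by
  simp [mk, pureTensor, TensorProduct.add_tmul, TensorProduct.tmul_add]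

lemma mk_smul_left (c : k) (φ : U ⟶ X ⊗ Y) (s : Sec F X) (t : Sec G Y) :
    mk φ (c • s) t = c • mk φ s t := by
  simp only [mk, pureTensor, ← TensorProduct.smul_tmul', TensorProduct.tmul_smul, map_smul]

lemma mk_add_right (φ : U ⟶ X ⊗ Y) (s : Sec F X) (t t' : Sec G Y) :
    mk φ s (t + t') = mk φ s t + mk φ s t' := by
  simp [mk, pureTensor, TensorProduct.tmul_add]

lemma mk_smul_right (c : k) (φ : U ⟶ X ⊗ Y) (s : Sec F X) (t : Sec G Y) :
    mk φ s (c • t) = c • mk φ s t := by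
  simp only [mk, pureTensor, TensorProduct.tmul_smul, map_smul]

end MkLinear

lemma day_induction {F G : LinPsh k C} {U : C} {P : DaySec F G U → Prop}
    (zero : P 0) (add : ∀ z w, P z → P w → P (z + w))
    (pure : ∀ {X Y : C} (φ : U ⟶ X ⊗ Y) (s : Sec F X) (t : Sec G Y), P (mk φ s t))
    (z : DaySec F G U) : P z := by
  classical
  obtain ⟨z, rfl⟩ : ∃ y, dayQ F G U y = z := (dayRel F G U).mkQ_surjective z
  induction z using DirectSum.induction_on with
  | zero => rw [map_zero]; exact zero
  | add z w hz hw => rw [map_add]; exact add _ _ hz hw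
  | of p z =>
    obtain ⟨X, Y⟩ := p
    induction z using TensorProduct.induction_on with
    | zero => rw [map_zero, map_zero]; exact zero
    | add z w hz hw => rw [map_add, map_add]; exact add _ _ hz hw
    | tmul φ z =>
      induction z using TensorProduct.induction_on with
      | zero => rw [TensorProduct.tmul_zero, map_zero, map_zero]; exact zero
      | add z w hz hw => rw [TensorProduct.tmul_add, map_add, map_add]; exact add _ _ hz hw
      | tmul s t =>
        convert pure φ s t using 1
        simp only [mk, pureTensor, DirectSum.lof_eq_of]

lemma day_lin_ext {F G : LinPsh k C} {U : C} {M : Type*} [AddCommGroup M] [Module k M]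
    {f g : DaySec F G U →ₗ[k] M}
    (h : ∀ {X Y : C} (φ : U ⟶ X ⊗ Y) (s : Sec F X) (t : Sec G Y), f (mk φ s t) = g (mk φ s t)) :
    f = g := by
  refine LinearMap.ext fun z => ?_
  induction z using day_induction with
  | zero => simp
  | add z w hz hw => simp [hz, hw]
  | pure φ s t => exact h φ s t

open scoped Classical in
/-- The linear map out of the sections of a Day convolution product given by a trilinear family
which is compatible with the coend relations. -/
def dayLift {F G : LinPsh k C} {U : C} {M : Type u} [AddCommGroup M] [Module k M]
    (θ : ∀ X Y : C, (U ⟶ X ⊗ Y) →ₗ[k] Sec F X →ₗ[k] Sec G Y →ₗ[k] M)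
    (hθ : ∀ (X Y X' Y' : C) (φ : U ⟶ X' ⊗ Y') (α : X' ⟶ X) (β : Y' ⟶ Y) (s : Sec F X)
      (t : Sec G Y), θ X Y (φ ≫ (α ⊗ₘ β)) s t = θ X' Y' φ (res F α s) (res G β t)) :
    DaySec F G U →ₗ[k] M :=
  (dayRel F G U).liftQ
    (DirectSum.toModule k (C × C) M fun p =>
      TensorProduct.lift (TensorProduct.uncurry (.id k) (Sec F p.1) (Sec G p.2) M ∘ₗ θ p.1 p.2))
    (by
      unfold dayRel
      refine Submodule.span_le.2 ?_
      rintro _ ⟨X, Y, X', Y', φ, α, β, s, t, rfl⟩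
      simp [pureTensor, hθ])

@[simp] lemma dayLift_mk {F G : LinPsh k C} {U : C} {M : Type u} [AddCommGroup M] [Module k M]
    (θ : ∀ X Y : C, (U ⟶ X ⊗ Y) →ₗ[k] Sec F X →ₗ[k] Sec G Y →ₗ[k] M)
    (hθ : ∀ (X Y X' Y' : C) (φ : U ⟶ X' ⊗ Y') (α : X' ⟶ X) (β : Y' ⟶ Y) (s : Sec F X)
      (t : Sec G Y), θ X Y (φ ≫ (α ⊗ₘ β)) s t = θ X' Y' φ (res F α s) (res G β t))
    {X Y : C} (φ : U ⟶ X ⊗ Y) (s : Sec F X) (t : Sec G Y) :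
    dayLift θ hθ (mk φ s t) = θ X Y φ s t := by
  refine ((dayRel F G U).liftQ_apply _ _).trans ?_
  simp [pureTensor]

/-- The linear map `C(U, V) → Hom(F(V), F(U))` given by restriction. -/
def resHom (F : LinPsh k C) (U V : C) : (U ⟶ V) →ₗ[k] Sec F V →ₗ[k] Sec F U where
  toFun f := res F f
  map_add' f g := LinearMap.ext fun s => res_add F f g s
  map_smul' c f := LinearMap.ext fun s => res_smul F c f s

/-- The restriction map of the Day convolution product along `f : U' ⟶ U`: it sends the class of
`φ ⊗ s ⊗ t` to the class of `(f ≫ φ) ⊗ s ⊗ t`. -/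
def dayRes (F G : LinPsh k C) {U' U : C} (f : U' ⟶ U) : DaySec F G U →ₗ[k] DaySec F G U' :=
  dayLift
    (fun X Y =>
      LinearMap.mk₂ k (fun φ s =>
        { toFun := fun t => mk (f ≫ φ) s t
          map_add' := fun t t' => mk_add_right _ _ _ _
          map_smul' := fun c t => mk_smul_right _ _ _ _ })
        (fun φ ψ s => LinearMap.ext fun t => by simp [mk_add_hom])
        (fun c φ s => LinearMap.ext fun t => by simp [mk_smul_hom])
        (fun φ s s' => LinearMap.ext fun t => by simp [mk_add_left])
        (fun c φ s => LinearMap.ext fun t => by simp [mk_smul_left]))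
    (fun _ _ _ _ φ α β s t => by simpa using mk_rel (f ≫ φ) α β s t)

lemma dayRes_mk {F G : LinPsh k C} {U' U X Y : C} (f : U' ⟶ U) (φ : U ⟶ X ⊗ Y) (s : Sec F X)
    (t : Sec G Y) : dayRes F G f (mk φ s t) = mk (f ≫ φ) s t := by
  rw [dayRes, dayLift_mk]
  rfl

/-- The Day convolution product `F ⊗ G` of two linear presheaves. -/
def day (F G : LinPsh k C) : LinPsh k C :=
  mkPsh (k := k) (DaySec F G) (fun f => dayRes F G f)
    (fun X z => by
      induction z using day_induction with
      | zero => rw [map_zero]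
      | add z w hz hw => rw [map_add, hz, hw]
      | pure φ s t => rw [dayRes_mk, Category.id_comp])
    (fun f g z => by
      induction z using day_induction with
      | zero => simp only [map_zero]
      | add z w hz hw => simp only [map_add, hz, hw]
      | pure φ s t => simp only [dayRes_mk, Category.assoc])
    (fun f g z => by
      induction z using day_induction with
      | zero => simp only [map_zero, add_zero]
      | add z w hz hw => simp only [map_add, hz, hw]; abel
      | pure φ s t => simp only [dayRes_mk, Preadditive.add_comp, mk_add_hom])
    (fun c f z => by
      induction z using day_induction with
      | zero => simp only [map_zero, smul_zero]
      | add z w hz hw => simp only [map_add, hz, hw, smul_add]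
      | pure φ s t => simp only [dayRes_mk, Linear.smul_comp, mk_smul_hom])

/-- The universal bilinear map `F(X) × G(Y) → (F ⊗ G)(X ⊗ Y)`. -/
def tm {F G : LinPsh k C} {X Y : C} (s : Sec F X) (t : Sec G Y) : Sec (day F G) (X ⊗ Y) :=
  mk (𝟙 (X ⊗ Y)) s t

/-- The class of `φ ⊗ s ⊗ t`, as a section of the presheaf `F ⊗ G`. -/
def cls {F G : LinPsh k C} {U X Y : C} (φ : U ⟶ X ⊗ Y) (s : Sec F X) (t : Sec G Y) :
    Sec (day F G) U := mk φ s t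

lemma res_cls {F G : LinPsh k C} {U' U X Y : C} (f : U' ⟶ U) (φ : U ⟶ X ⊗ Y) (s : Sec F X)
    (t : Sec G Y) : res (day F G) f (cls φ s t) = cls (f ≫ φ) s t :=
  dayRes_mk f φ s t

lemma res_tm {F G : LinPsh k C} {U X Y : C} (φ : U ⟶ X ⊗ Y) (s : Sec F X) (t : Sec G Y) :
    res (day F G) φ (tm s t) = cls φ s t := by
  have := res_cls φ (𝟙 (X ⊗ Y)) s t
  rwa [Category.comp_id] at this

section TmLinear

variable {F G : LinPsh k C} {X Y : C}

@[simp] lemma tm_add_left (s s' : Sec F X) (t : Sec G Y) : tm (s + s') t = tm s t + tm s' t :=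
  mk_add_left _ _ _ _
@[simp] lemma tm_smul_left (c : k) (s : Sec F X) (t : Sec G Y) : tm (c • s) t = c • tm s t :=
  mk_smul_left _ _ _ _
@[simp] lemma tm_add_right (s : Sec F X) (t t' : Sec G Y) : tm s (t + t') = tm s t + tm s t' :=
  mk_add_right _ _ _ _
@[simp] lemma tm_smul_right (c : k) (s : Sec F X) (t : Sec G Y) : tm s (c • t) = c • tm s t :=
  mk_smul_right _ _ _ _

@[simp] lemma tm_zero_left (t : Sec G Y) : tm (0 : Sec F X) t = 0 := by
  simpa using tm_smul_left (0 : k) (0 : Sec F X) t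

@[simp] lemma tm_zero_right (s : Sec F X) : tm s (0 : Sec G Y) = 0 := by
  simpa using tm_smul_right (0 : k) s (0 : Sec G Y)

end TmLinear

lemma tm_res {F G : LinPsh k C} {X Y X' Y' : C} (α : X' ⟶ X) (β : Y' ⟶ Y) (s : Sec F X)
    (t : Sec G Y) : tm (res F α s) (res G β t) = res (day F G) (α ⊗ₘ β) (tm s t) := by
  rw [res_tm]
  have := mk_rel (𝟙 (X' ⊗ Y')) α β s t
  rw [Category.id_comp] at this
  exact this.symm

lemma tm_res_left {F G : LinPsh k C} {X Y X' : C} (α : X' ⟶ X) (s : Sec F X)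
    (t : Sec G Y) : tm (res F α s) t = res (day F G) (α ▷ Y) (tm s t) := by
  simpa using tm_res α (𝟙 Y) s t

lemma tm_res_right {F G : LinPsh k C} {X Y Y' : C} (β : Y' ⟶ Y) (s : Sec F X)
    (t : Sec G Y) : tm s (res G β t) = res (day F G) (X ◁ β) (tm s t) := by
  simpa using tm_res (𝟙 X) β s t

/-- Every property of sections of `F ⊗ G` which is stable under sums and restrictions and holds
for the sections `tm s t` holds for all sections. -/
lemma sec_induction {F G : LinPsh k C} {P : ∀ {U : C}, Sec (day F G) U → Prop}
    (zero : ∀ U : C, P (0 : Sec (day F G) U))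
    (add : ∀ {U : C} (z w : Sec (day F G) U), P z → P w → P (z + w))
    (res_tm' : ∀ {U X Y : C} (φ : U ⟶ X ⊗ Y) (s : Sec F X) (t : Sec G Y),
      P (res (day F G) φ (tm s t)))
    {U : C} (z : Sec (day F G) U) : P z := by
  refine day_induction (F := F) (G := G) (P := fun z => P (U := U) z) (zero U)
    (fun z w hz hw => add z w hz hw) (fun φ s t => ?_) z
  have := res_tm' φ s t
  rwa [res_tm] at this

/-- A bilinear morphism from `(F, G)` to `H`: a family of bilinear maps
`F(X) × G(Y) → H(X ⊗ Y)`, natural in `X` and `Y`. -/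
structure Bihom (F G H : LinPsh k C) where
  toFun : ∀ {X Y : C}, Sec F X → Sec G Y → Sec H (X ⊗ Y)
  add_left : ∀ {X Y : C} (s s' : Sec F X) (t : Sec G Y),
    toFun (s + s') t = toFun s t + toFun s' t
  smul_left : ∀ {X Y : C} (c : k) (s : Sec F X) (t : Sec G Y), toFun (c • s) t = c • toFun s t
  add_right : ∀ {X Y : C} (s : Sec F X) (t t' : Sec G Y),
    toFun s (t + t') = toFun s t + toFun s t'
  smul_right : ∀ {X Y : C} (c : k) (s : Sec F X) (t : Sec G Y), toFun s (c • t) = c • toFun s t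
  nat : ∀ {X Y X' Y' : C} (α : X' ⟶ X) (β : Y' ⟶ Y) (s : Sec F X) (t : Sec G Y),
    toFun (res F α s) (res G β t) = res H (α ⊗ₘ β) (toFun s t)

/-- The map of sections over `U` which corresponds to a bilinear morphism: it sends the class of
`φ ⊗ s ⊗ t` to `φ^* b(s, t)`. -/
def descSec {F G H : LinPsh k C} (b : Bihom F G H) (U : C) : DaySec F G U →ₗ[k] Sec H U :=
  dayLift
    (fun X Y =>
      LinearMap.mk₂ k (fun φ s =>
        { toFun := fun t => res H φ (b.toFun s t)
          map_add' := fun t t' => by rw [b.add_right, map_add]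
          map_smul' := fun c t => by rw [b.smul_right, map_smul]; rfl })
        (fun φ ψ s => LinearMap.ext fun t => by simp [res_add])
        (fun c φ s => LinearMap.ext fun t => by simp [res_smul])
        (fun φ s s' => LinearMap.ext fun t => by simp [b.add_left])
        (fun c φ s => LinearMap.ext fun t => by simp [b.smul_left]))
    (fun _ _ _ _ φ α β s t => by simp [res_comp, b.nat])

lemma descSec_mk {F G H : LinPsh k C} (b : Bihom F G H) {U X Y : C} (φ : U ⟶ X ⊗ Y)
    (s : Sec F X) (t : Sec G Y) : descSec b U (mk φ s t) = res H φ (b.toFun s t) := by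
  rw [descSec, dayLift_mk]
  rfl

lemma descSec_res {F G H : LinPsh k C} (b : Bihom F G H) {U' U : C} (f : U' ⟶ U)
    (z : DaySec F G U) : descSec b U' (dayRes F G f z) = res H f (descSec b U z) := by
  induction z using day_induction with
  | zero => simp only [map_zero]
  | add z w hz hw => simp only [map_add, hz, hw]
  | pure φ s t => rw [dayRes_mk, descSec_mk, descSec_mk, res_comp]

/-- The morphism `F ⊗ G ⟶ H` which corresponds to a bilinear morphism. -/
def desc {F G H : LinPsh k C} (b : Bihom F G H) : day F G ⟶ H :=
  mkHom (F := day F G) (descSec b) (fun f z => descSec_res b f z)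

@[simp] lemma desc_tm {F G H : LinPsh k C} (b : Bihom F G H) {X Y : C} (s : Sec F X)
    (t : Sec G Y) : app (desc b) (X ⊗ Y) (tm s t) = b.toFun s t :=
  (descSec_mk b (𝟙 (X ⊗ Y)) s t).trans (res_id H _ _)

lemma day_hom_ext {F G H : LinPsh k C} {f g : day F G ⟶ H}
    (h : ∀ {X Y : C} (s : Sec F X) (t : Sec G Y), app f _ (tm s t) = app g _ (tm s t)) :
    f = g := by
  refine psh_hom_ext fun U z => ?_
  induction z using sec_induction with
  | zero U => simp
  | add z w hz hw => simp only [map_add, hz, hw]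
  | res_tm' φ s t => rw [app_res, app_res, h]

/-- The bilinear morphism `(s, t) ↦ f(s) ⊗ g(t)`. -/
def dayMapBihom {F F' G G' : LinPsh k C} (f : F ⟶ F') (g : G ⟶ G') : Bihom F G (day F' G') where
  toFun s t := tm (app f _ s) (app g _ t)
  add_left s s' t := by simp
  smul_left c s t := by simp
  add_right s t t' := by simp
  smul_right c s t := by simp
  nat α β s t := by rw [app_res, app_res, tm_res]

/-- The tensor product `f ⊗ g` of morphisms: it sends `s ⊗ t` to `f(s) ⊗ g(t)`. -/
def dayMap {F F' G G' : LinPsh k C} (f : F ⟶ F') (g : G ⟶ G') : day F G ⟶ day F' G' :=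
  desc (dayMapBihom f g)

@[simp] lemma dayMap_tm {F F' G G' : LinPsh k C} (f : F ⟶ F') (g : G ⟶ G') {X Y : C}
    (s : Sec F X) (t : Sec G Y) :
    app (dayMap f g) (X ⊗ Y) (tm s t) = tm (app f X s) (app g Y t) :=
  desc_tm _ s t

section Ext

variable {F G H K L : LinPsh k C}

lemma day_hom_ext₃ {f g : day (day F G) H ⟶ K}
    (h : ∀ {X Y Z : C} (s : Sec F X) (t : Sec G Y) (u : Sec H Z),
      app f _ (tm (tm s t) u) = app g _ (tm (tm s t) u)) : f = g := by
  refine day_hom_ext fun {V Z} z u => ?_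
  induction z using sec_induction with
  | zero U => rw [tm_zero_left, map_zero, map_zero]
  | add z w hz hw => rw [tm_add_left, map_add, map_add, hz, hw]
  | res_tm' φ s t => rw [tm_res_left, app_res, app_res, h]

lemma day_hom_ext₃' {f g : day F (day G H) ⟶ K}
    (h : ∀ {X Y Z : C} (s : Sec F X) (t : Sec G Y) (u : Sec H Z),
      app f _ (tm s (tm t u)) = app g _ (tm s (tm t u))) : f = g := by
  refine day_hom_ext fun {V Z} u z => ?_
  induction z using sec_induction with
  | zero U => rw [tm_zero_right, map_zero, map_zero]
  | add z w hz hw => rw [tm_add_right, map_add, map_add, hz, hw]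
  | res_tm' φ s t => rw [tm_res_right, app_res, app_res, h]

lemma day_hom_ext₄ {f g : day (day (day F G) H) K ⟶ L}
    (h : ∀ {X Y Z W : C} (s : Sec F X) (t : Sec G Y) (u : Sec H Z) (v : Sec K W),
      app f _ (tm (tm (tm s t) u) v) = app g _ (tm (tm (tm s t) u) v)) : f = g := by
  refine day_hom_ext₃ fun {V Z W} z u v => ?_
  induction z using sec_induction with
  | zero U => rw [tm_zero_left, tm_zero_left, map_zero, map_zero]
  | add z w hz hw => rw [tm_add_left, tm_add_left, map_add, map_add, hz, hw]
  | res_tm' φ s t => rw [tm_res_left, tm_res_left, app_res, app_res, h]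

end Ext

variable [MonoidalPreadditive C] [MonoidalLinear k C]

/-- The presheaf `X ↦ F(X ⊗ W)`. -/
def shiftR (F : LinPsh k C) (W : C) : LinPsh k C :=
  mkPsh (k := k) (fun X => Sec F (X ⊗ W)) (fun f => res F (f ▷ W))
    (fun X s => by simp)
    (fun f g s => by rw [comp_whiskerRight, res_comp])
    (fun f g s => by rw [MonoidalPreadditive.add_whiskerRight, res_add])
    (fun c f s => by rw [MonoidalLinear.smul_whiskerRight, res_smul])

/-- The presheaf `X ↦ F(W ⊗ X)`. -/
def shiftL (F : LinPsh k C) (W : C) : LinPsh k C :=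
  mkPsh (k := k) (fun X => Sec F (W ⊗ X)) (fun f => res F (W ◁ f))
    (fun X s => by simp)
    (fun f g s => by rw [MonoidalCategory.whiskerLeft_comp, res_comp])
    (fun f g s => by rw [MonoidalPreadditive.whiskerLeft_add, res_add])
    (fun c f s => by rw [MonoidalLinear.whiskerLeft_smul, res_smul])

section Assoc

/-- A trilinear morphism from `(F, G, H)` to `K`: a family of trilinear maps
`F(X) × G(Y) × H(Z) → K((X ⊗ Y) ⊗ Z)`, natural in `X`, `Y` and `Z`. -/
structure Trihom (F G H K : LinPsh k C) where
  toFun : ∀ {X Y Z : C}, Sec F X → Sec G Y → Sec H Z → Sec K ((X ⊗ Y) ⊗ Z)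
  add₁ : ∀ {X Y Z : C} (s s' : Sec F X) (t : Sec G Y) (u : Sec H Z),
    toFun (s + s') t u = toFun s t u + toFun s' t u
  smul₁ : ∀ {X Y Z : C} (c : k) (s : Sec F X) (t : Sec G Y) (u : Sec H Z),
    toFun (c • s) t u = c • toFun s t u
  add₂ : ∀ {X Y Z : C} (s : Sec F X) (t t' : Sec G Y) (u : Sec H Z),
    toFun s (t + t') u = toFun s t u + toFun s t' u
  smul₂ : ∀ {X Y Z : C} (c : k) (s : Sec F X) (t : Sec G Y) (u : Sec H Z),
    toFun s (c • t) u = c • toFun s t u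
  add₃ : ∀ {X Y Z : C} (s : Sec F X) (t : Sec G Y) (u u' : Sec H Z),
    toFun s t (u + u') = toFun s t u + toFun s t u'
  smul₃ : ∀ {X Y Z : C} (c : k) (s : Sec F X) (t : Sec G Y) (u : Sec H Z),
    toFun s t (c • u) = c • toFun s t u
  nat : ∀ {X Y Z X' Y' Z' : C} (α : X' ⟶ X) (β : Y' ⟶ Y) (γ : Z' ⟶ Z) (s : Sec F X)
    (t : Sec G Y) (u : Sec H Z),
    toFun (res F α s) (res G β t) (res H γ u) = res K ((α ⊗ₘ β) ⊗ₘ γ) (toFun s t u)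

/-- The analogue of `Trihom` for families of maps
`F(X) × G(Y) × H(Z) → K(X ⊗ (Y ⊗ Z))`. -/
structure Trihom' (F G H K : LinPsh k C) where
  toFun : ∀ {X Y Z : C}, Sec F X → Sec G Y → Sec H Z → Sec K (X ⊗ (Y ⊗ Z))
  add₁ : ∀ {X Y Z : C} (s s' : Sec F X) (t : Sec G Y) (u : Sec H Z),
    toFun (s + s') t u = toFun s t u + toFun s' t u
  smul₁ : ∀ {X Y Z : C} (c : k) (s : Sec F X) (t : Sec G Y) (u : Sec H Z),
    toFun (c • s) t u = c • toFun s t u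
  add₂ : ∀ {X Y Z : C} (s : Sec F X) (t t' : Sec G Y) (u : Sec H Z),
    toFun s (t + t') u = toFun s t u + toFun s t' u
  smul₂ : ∀ {X Y Z : C} (c : k) (s : Sec F X) (t : Sec G Y) (u : Sec H Z),
    toFun s (c • t) u = c • toFun s t u
  add₃ : ∀ {X Y Z : C} (s : Sec F X) (t : Sec G Y) (u u' : Sec H Z),
    toFun s t (u + u') = toFun s t u + toFun s t u'
  smul₃ : ∀ {X Y Z : C} (c : k) (s : Sec F X) (t : Sec G Y) (u : Sec H Z),
    toFun s t (c • u) = c • toFun s t u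
  nat : ∀ {X Y Z X' Y' Z' : C} (α : X' ⟶ X) (β : Y' ⟶ Y) (γ : Z' ⟶ Z) (s : Sec F X)
    (t : Sec G Y) (u : Sec H Z),
    toFun (res F α s) (res G β t) (res H γ u) = res K (α ⊗ₘ (β ⊗ₘ γ)) (toFun s t u)

variable {F G H K : LinPsh k C}

/-- A trilinear morphism with its third argument fixed, as a bilinear morphism. -/
def Trihom.fix (T : Trihom F G H K) {Z : C} (u : Sec H Z) : Bihom F G (shiftR K Z) where
  toFun s t := T.toFun s t u
  add_left s s' t := T.add₁ s s' t u
  smul_left c s t := T.smul₁ c s t u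
  add_right s t t' := T.add₂ s t t' u
  smul_right c s t := T.smul₂ c s t u
  nat α β s t := by
    have := T.nat α β (𝟙 Z) s t u
    rw [res_id, tensorHom_id] at this
    exact this

/-- A trilinear morphism, as a map on `(F ⊗ G)(V) × H(Z)`. -/
def Trihom.cur (T : Trihom F G H K) {V Z : C} (u : Sec H Z) :
    Sec (day F G) V →ₗ[k] Sec K (V ⊗ Z) :=
  app (desc (T.fix u)) V

lemma Trihom.cur_tm (T : Trihom F G H K) {X Y Z : C} (s : Sec F X) (t : Sec G Y)
    (u : Sec H Z) : T.cur u (tm s t) = T.toFun s t u :=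
  desc_tm (T.fix u) s t

lemma Trihom.cur_res (T : Trihom F G H K) {V' V Z : C} (f : V' ⟶ V) (z : Sec (day F G) V)
    (u : Sec H Z) : T.cur u (res (day F G) f z) = res K (f ▷ Z) (T.cur u z) :=
  app_res (desc (T.fix u)) f z

/-- The bilinear morphism from `(F ⊗ G, H)` to `K` which corresponds to a trilinear morphism. -/
def Trihom.toBihom (T : Trihom F G H K) : Bihom (day F G) H K where
  toFun z u := T.cur u z
  add_left z z' u := map_add _ _ _
  smul_left c z u := map_smul _ _ _
  add_right z u u' := by
    induction z using sec_induction with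
    | zero U => simp only [map_zero, add_zero]
    | add z w hz hw => simp only [map_add, hz, hw]; abel
    | res_tm' φ s t => simp only [T.cur_res, T.cur_tm, T.add₃, map_add]
  smul_right c z u := by
    induction z using sec_induction with
    | zero U => simp only [map_zero, smul_zero]
    | add z w hz hw => simp only [map_add, hz, hw, smul_add]
    | res_tm' φ s t => simp only [T.cur_res, T.cur_tm, T.smul₃, map_smul]
  nat α β z u := by
    rw [T.cur_res, MonoidalCategory.tensorHom_def, res_comp]
    congr 1
    induction z using sec_induction with
    | zero U => simp only [map_zero]
    | add z w hz hw => simp only [map_add, hz α, hw α]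
    | res_tm' φ s t =>
      have := T.nat (𝟙 _) (𝟙 _) β s t u
      rw [res_id, res_id, id_tensorHom_id, id_tensorHom] at this
      rw [T.cur_res, T.cur_res, T.cur_tm, T.cur_tm, this, ← res_comp, ← res_comp,
        whisker_exchange]

/-- The morphism `(F ⊗ G) ⊗ H ⟶ K` which corresponds to a trilinear morphism. -/
def Trihom.desc (T : Trihom F G H K) : day (day F G) H ⟶ K := DayCoalg.desc T.toBihom

lemma Trihom.desc_tm (T : Trihom F G H K) {X Y Z : C} (s : Sec F X) (t : Sec G Y)
    (u : Sec H Z) : app T.desc _ (tm (tm s t) u) = T.toFun s t u :=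
  (DayCoalg.desc_tm T.toBihom (tm s t) u).trans (T.cur_tm s t u)

/-- A trilinear morphism with its first argument fixed, as a bilinear morphism. -/
def Trihom'.fix (T : Trihom' F G H K) {X : C} (s : Sec F X) : Bihom G H (shiftL K X) where
  toFun t u := T.toFun s t u
  add_left t t' u := T.add₂ s t t' u
  smul_left c t u := T.smul₂ c s t u
  add_right t u u' := T.add₃ s t u u'
  smul_right c t u := T.smul₃ c s t u
  nat α β t u := by
    have := T.nat (𝟙 X) α β s t u
    rw [res_id, id_tensorHom] at this
    exact this

/-- A trilinear morphism, as a map on `F(X) × (G ⊗ H)(V)`. -/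
def Trihom'.cur (T : Trihom' F G H K) {X V : C} (s : Sec F X) :
    Sec (day G H) V →ₗ[k] Sec K (X ⊗ V) :=
  app (DayCoalg.desc (T.fix s)) V

lemma Trihom'.cur_tm (T : Trihom' F G H K) {X Y Z : C} (s : Sec F X) (t : Sec G Y)
    (u : Sec H Z) : T.cur s (tm t u) = T.toFun s t u :=
  DayCoalg.desc_tm (T.fix s) t u

lemma Trihom'.cur_res (T : Trihom' F G H K) {X V' V : C} (f : V' ⟶ V) (s : Sec F X)
    (z : Sec (day G H) V) : T.cur s (res (day G H) f z) = res K (X ◁ f) (T.cur s z) :=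
  app_res (DayCoalg.desc (T.fix s)) f z

/-- The bilinear morphism from `(F, G ⊗ H)` to `K` which corresponds to a trilinear morphism. -/
def Trihom'.toBihom (T : Trihom' F G H K) : Bihom F (day G H) K where
  toFun s z := T.cur s z
  add_right s z z' := map_add _ _ _
  smul_right c s z := map_smul _ _ _
  add_left s s' z := by
    induction z using sec_induction with
    | zero U => simp only [map_zero, add_zero]
    | add z w hz hw => simp only [map_add, hz, hw]; abel
    | res_tm' φ t u => simp only [T.cur_res, T.cur_tm, T.add₁, map_add]
  smul_left c s z := by
    induction z using sec_induction with
    | zero U => simp only [map_zero, smul_zero]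
    | add z w hz hw => simp only [map_add, hz, hw, smul_add]
    | res_tm' φ t u => simp only [T.cur_res, T.cur_tm, T.smul₁, map_smul]
  nat α β s z := by
    rw [T.cur_res, MonoidalCategory.tensorHom_def', res_comp]
    congr 1
    induction z using sec_induction with
    | zero U => simp only [map_zero]
    | add z w hz hw => simp only [map_add, hz β, hw β]
    | res_tm' φ t u =>
      have := T.nat α (𝟙 _) (𝟙 _) s t u
      rw [res_id, res_id, id_tensorHom_id, tensorHom_id] at this
      rw [T.cur_res, T.cur_res, T.cur_tm, T.cur_tm, this, ← res_comp, ← res_comp,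
        whisker_exchange]

/-- The morphism `F ⊗ (G ⊗ H) ⟶ K` which corresponds to a trilinear morphism. -/
def Trihom'.desc (T : Trihom' F G H K) : day F (day G H) ⟶ K := DayCoalg.desc T.toBihom

lemma Trihom'.desc_tm (T : Trihom' F G H K) {X Y Z : C} (s : Sec F X) (t : Sec G Y)
    (u : Sec H Z) : app T.desc _ (tm s (tm t u)) = T.toFun s t u :=
  (DayCoalg.desc_tm T.toBihom s (tm t u)).trans (T.cur_tm s t u)

variable (F G H)

/-- The trilinear morphism `(s, t, u) ↦ s ⊗ (t ⊗ u)`. -/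
def assocTri : Trihom F G H (day F (day G H)) where
  toFun {X Y Z} s t u := res (day F (day G H)) (α_ X Y Z).hom (tm s (tm t u))
  add₁ s s' t u := by simp
  smul₁ c s t u := by simp
  add₂ s t t' u := by simp
  smul₂ c s t u := by simp
  add₃ s t u u' := by simp
  smul₃ c s t u := by simp
  nat α β γ s t u := by
    rw [tm_res β γ, tm_res, ← res_comp, ← res_comp, associator_naturality]

/-- The trilinear morphism `(s, t, u) ↦ (s ⊗ t) ⊗ u`. -/
def assocTri' : Trihom' F G H (day (day F G) H) where
  toFun {X Y Z} s t u := res (day (day F G) H) (α_ X Y Z).inv (tm (tm s t) u)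
  add₁ s s' t u := by simp
  smul₁ c s t u := by simp
  add₂ s t t' u := by simp
  smul₂ c s t u := by simp
  add₃ s t u u' := by simp
  smul₃ c s t u := by simp
  nat α β γ s t u := by
    rw [tm_res α β, tm_res, ← res_comp, ← res_comp, associator_inv_naturality]

/-- The associator `(F ⊗ G) ⊗ H ≅ F ⊗ (G ⊗ H)`, which sends `(s ⊗ t) ⊗ u` to the restriction of
`s ⊗ (t ⊗ u)` along the associator of `C`. -/
def dayAssoc : day (day F G) H ≅ day F (day G H) where
  hom := (assocTri F G H).desc
  inv := (assocTri' F G H).desc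
  hom_inv_id := day_hom_ext₃ fun s t u => by
    rw [app_comp, Trihom.desc_tm, assocTri, app_res, Trihom'.desc_tm, assocTri', ← res_comp,
      Iso.hom_inv_id, res_id, app_id]
  inv_hom_id := day_hom_ext₃' fun s t u => by
    rw [app_comp, Trihom'.desc_tm, assocTri', app_res, Trihom.desc_tm, assocTri, ← res_comp,
      Iso.inv_hom_id, res_id, app_id]

variable {F G H}

@[simp] lemma dayAssoc_hom_tm {X Y Z : C} (s : Sec F X) (t : Sec G Y) (u : Sec H Z) :
    app (dayAssoc F G H).hom _ (tm (tm s t) u) =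
      res (day F (day G H)) (α_ X Y Z).hom (tm s (tm t u)) :=
  Trihom.desc_tm _ s t u

@[simp] lemma dayAssoc_inv_tm {X Y Z : C} (s : Sec F X) (t : Sec G Y) (u : Sec H Z) :
    app (dayAssoc F G H).inv _ (tm s (tm t u)) =
      res (day (day F G) H) (α_ X Y Z).inv (tm (tm s t) u) :=
  Trihom'.desc_tm _ s t u

end Assoc

section Unit

variable (F : LinPsh k C)

/-- The bilinear morphism `(φ, s) ↦ φ^* s` on `C(X, 𝟙) × F(Y)`. -/
def leftBihom : Bihom (rep k (𝟙_ C)) F F where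
  toFun {X Y} φ s := res F ((show X ⟶ 𝟙_ C from φ) ▷ Y ≫ (λ_ Y).hom) s
  add_left {X Y} φ ψ s := by
    refine Eq.trans ?_ (res_add F _ _ s)
    rw [← Preadditive.add_comp, ← MonoidalPreadditive.add_whiskerRight]
    rfl
  smul_left {X Y} c φ s := by
    refine Eq.trans ?_ (res_smul F c _ s)
    rw [← Linear.smul_comp, ← MonoidalLinear.smul_whiskerRight]
    rfl
  add_right φ s s' := map_add _ _ _
  smul_right c φ s := map_smul _ _ _
  nat {X Y X' Y'} α β φ s := by
    have key : ∀ f : X ⟶ 𝟙_ C,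
        ((α ≫ f) ▷ Y' ≫ (λ_ Y').hom) ≫ β = (α ⊗ₘ β) ≫ f ▷ Y ≫ (λ_ Y).hom := fun f => by
      simp [MonoidalCategory.tensorHom_def, whisker_exchange_assoc]
    change res F ((α ≫ (show X ⟶ 𝟙_ C from φ)) ▷ Y' ≫ (λ_ Y').hom) (res F β s) = _
    rw [← res_comp, ← res_comp, key]

/-- The bilinear morphism `(s, φ) ↦ φ^* s` on `F(X) × C(Y, 𝟙)`. -/
def rightBihom : Bihom F (rep k (𝟙_ C)) F where
  toFun {X Y} s φ := res F (X ◁ (show Y ⟶ 𝟙_ C from φ) ≫ (ρ_ X).hom) s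
  add_right {X Y} s φ ψ := by
    refine Eq.trans ?_ (res_add F _ _ s)
    rw [← Preadditive.add_comp, ← MonoidalPreadditive.whiskerLeft_add]
    rfl
  smul_right {X Y} c s φ := by
    refine Eq.trans ?_ (res_smul F c _ s)
    rw [← Linear.smul_comp, ← MonoidalLinear.whiskerLeft_smul]
    rfl
  add_left s s' φ := map_add _ _ _
  smul_left c s φ := map_smul _ _ _
  nat {X Y X' Y'} α β s φ := by
    have key : ∀ f : Y ⟶ 𝟙_ C,
        (X' ◁ (β ≫ f) ≫ (ρ_ X').hom) ≫ α = (α ⊗ₘ β) ≫ X ◁ f ≫ (ρ_ X).hom := fun f => by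
      simp [MonoidalCategory.tensorHom_def', ← whisker_exchange_assoc]
    change res F (X' ◁ (β ≫ (show Y ⟶ 𝟙_ C from φ)) ≫ (ρ_ X').hom) (res F α s) = _
    rw [← res_comp, ← res_comp, key]

/-- The identity of the unit object, as a section of the unit presheaf. -/
def one : Sec (rep k (𝟙_ C)) (𝟙_ C) := 𝟙 (𝟙_ C)

lemma res_one {X : C} (φ : X ⟶ 𝟙_ C) :
    res (rep k (𝟙_ C)) φ one = (show Sec (rep k (𝟙_ C)) X from φ) :=
  Category.comp_id φ

/-- Sections of the unit presheaf are restrictions of the identity. -/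
lemma exists_res_one {X : C} (s : Sec (rep k (𝟙_ C)) X) :
    ∃ φ : X ⟶ 𝟙_ C, s = res (rep k (𝟙_ C)) φ one :=
  ⟨s, (res_one _).symm⟩

/-- The left unitor `C(-, 𝟙) ⊗ F ≅ F`, which sends `φ ⊗ s` to `φ^* s`. -/
def dayLeftUnitor : day (rep k (𝟙_ C)) F ≅ F where
  hom := desc (leftBihom F)
  inv := mkHom (G := day (rep k (𝟙_ C)) F)
    (fun X =>
      { toFun := fun s => res (day (rep k (𝟙_ C)) F) (λ_ X).inv (tm one s)
        map_add' := fun s s' => by simp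
        map_smul' := fun c s => by simp })
    (fun {X Y} f s => by
      change res _ (λ_ X).inv (tm one (res F f s)) = res _ f (res _ (λ_ Y).inv (tm one s))
      rw [tm_res_right, ← res_comp, ← res_comp, leftUnitor_inv_naturality])
  hom_inv_id := day_hom_ext fun {X Y} φ s => by
    obtain ⟨φ, rfl⟩ := exists_res_one φ
    rw [app_comp, tm_res_left, app_res, app_res, desc_tm]
    change res _ _ (res _ (λ_ _).inv (tm one (res F (𝟙 (𝟙_ C) ▷ Y ≫ (λ_ Y).hom) s))) = _
    rw [tm_res_right, ← res_comp, ← res_comp, app_id]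
    congr 2
    simp
  inv_hom_id := psh_hom_ext fun X s => by
    change app (desc (leftBihom F)) X (res _ (λ_ X).inv (tm one s)) = s
    rw [app_res, desc_tm]
    change res F _ (res F (𝟙 (𝟙_ C) ▷ X ≫ (λ_ X).hom) s) = s
    rw [← res_comp]
    simp

/-- The right unitor `F ⊗ C(-, 𝟙) ≅ F`, which sends `s ⊗ φ` to `φ^* s`. -/
def dayRightUnitor : day F (rep k (𝟙_ C)) ≅ F where
  hom := desc (rightBihom F)
  inv := mkHom (G := day F (rep k (𝟙_ C)))
    (fun X =>
      { toFun := fun s => res (day F (rep k (𝟙_ C))) (ρ_ X).inv (tm s one)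
        map_add' := fun s s' => by simp
        map_smul' := fun c s => by simp })
    (fun {X Y} f s => by
      change res _ (ρ_ X).inv (tm (res F f s) one) = res _ f (res _ (ρ_ Y).inv (tm s one))
      rw [tm_res_left, ← res_comp, ← res_comp, rightUnitor_inv_naturality])
  hom_inv_id := day_hom_ext fun {X Y} s φ => by
    obtain ⟨φ, rfl⟩ := exists_res_one φ
    rw [app_comp, tm_res_right, app_res, app_res, desc_tm]
    change res _ _ (res _ (ρ_ _).inv (tm (res F (X ◁ 𝟙 (𝟙_ C) ≫ (ρ_ X).hom) s) one)) = _
    rw [tm_res_left, ← res_comp, ← res_comp, app_id]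
    congr 2
    simp
  inv_hom_id := psh_hom_ext fun X s => by
    change app (desc (rightBihom F)) X (res _ (ρ_ X).inv (tm s one)) = s
    rw [app_res, desc_tm]
    change res F _ (res F (X ◁ 𝟙 (𝟙_ C) ≫ (ρ_ X).hom) s) = s
    rw [← res_comp]
    simp

variable {F}

lemma dayLeftUnitor_hom_tm {X : C} (s : Sec F X) :
    app (dayLeftUnitor F).hom _ (tm one s) = res F (λ_ X).hom s := by
  refine (desc_tm (leftBihom F) one s).trans ?_
  change res F (𝟙 (𝟙_ C) ▷ X ≫ (λ_ X).hom) s = _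
  rw [id_whiskerRight, Category.id_comp]

lemma dayRightUnitor_hom_tm {X : C} (s : Sec F X) :
    app (dayRightUnitor F).hom _ (tm s one) = res F (ρ_ X).hom s := by
  refine (desc_tm (rightBihom F) s one).trans ?_
  change res F (X ◁ 𝟙 (𝟙_ C) ≫ (ρ_ X).hom) s = _
  rw [whiskerLeft_id, Category.id_comp]

end Unit

/-- The monoidal structure on linear presheaves given by the Day convolution product, with unit
the presheaf represented by the unit object of `C`. -/
instance : MonoidalCategory (LinPsh k C) where
  tensorObj := day
  tensorHom := dayMap
  whiskerLeft F _ _ g := dayMap (𝟙 F) g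
  whiskerRight f G := dayMap f (𝟙 G)
  tensorUnit := rep k (𝟙_ C)
  associator := dayAssoc
  leftUnitor := dayLeftUnitor
  rightUnitor := dayRightUnitor
  tensorHom_def f g := day_hom_ext fun s t => by simp
  id_tensorHom_id F G := day_hom_ext fun s t => by simp
  tensorHom_comp_tensorHom f g f' g' := day_hom_ext fun s t => by simp
  whiskerLeft_id F G := day_hom_ext fun s t => by simp
  id_whiskerRight F G := day_hom_ext fun s t => by simp
  associator_naturality f g h := day_hom_ext₃ fun s t u => by simp [app_res]
  leftUnitor_naturality f := day_hom_ext fun φ s => by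
    obtain ⟨φ, rfl⟩ := exists_res_one φ
    simp [tm_res_left, app_res, dayLeftUnitor_hom_tm]
  rightUnitor_naturality f := day_hom_ext fun s φ => by
    obtain ⟨φ, rfl⟩ := exists_res_one φ
    simp [tm_res_right, app_res, dayRightUnitor_hom_tm]
  pentagon F G H K := day_hom_ext₄ fun {X Y Z W} s t u v => by
    simp only [app_comp, dayMap_tm, dayAssoc_hom_tm, app_id, app_res, tm_res_left, tm_res_right,
      ← res_comp]
    rw [MonoidalCategory.pentagon]
  triangle F G := day_hom_ext₃ fun {X Y Z} s φ t => by
    obtain ⟨φ, rfl⟩ := exists_res_one φ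
    simp only [app_comp, dayMap_tm, dayAssoc_hom_tm, app_id, app_res, tm_res_left, tm_res_right,
      dayLeftUnitor_hom_tm, dayRightUnitor_hom_tm, ← res_comp]
    congr 2
    simp

section Braiding

variable [SymmetricCategory C]

/-- The bilinear morphism `(s, t) ↦ t ⊗ s`. -/
def braidBihom (F G : LinPsh k C) : Bihom F G (day G F) where
  toFun {X Y} s t := res (day G F) (β_ X Y).hom (tm t s)
  add_left s s' t := by simp
  smul_left c s t := by simp
  add_right s t t' := by simp
  smul_right c s t := by simp
  nat α β s t := by
    rw [tm_res, ← res_comp, ← res_comp, BraidedCategory.braiding_naturality]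

/-- The symmetry `F ⊗ G ⟶ G ⊗ F`, which sends `s ⊗ t` to the restriction of `t ⊗ s` along the
symmetry of `C`. -/
def dayBraid (F G : LinPsh k C) : day F G ⟶ day G F := desc (braidBihom F G)

@[simp] lemma dayBraid_tm {F G : LinPsh k C} {X Y : C} (s : Sec F X) (t : Sec G Y) :
    app (dayBraid F G) _ (tm s t) = res (day G F) (β_ X Y).hom (tm t s) :=
  desc_tm _ s t

lemma dayBraid_dayBraid (F G : LinPsh k C) : dayBraid F G ≫ dayBraid G F = 𝟙 (day F G) :=
  day_hom_ext fun s t => by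
    simp [app_res, ← res_comp]

/-- The symmetric monoidal structure given by the Day convolution product. -/
instance : SymmetricCategory (LinPsh k C) where
  braiding F G :=
    { hom := dayBraid F G
      inv := dayBraid G F
      hom_inv_id := dayBraid_dayBraid F G
      inv_hom_id := dayBraid_dayBraid G F }
  braiding_naturality_right F _ _ g := day_hom_ext fun s t => by
    change app (dayMap (𝟙 F) g ≫ dayBraid _ _) _ _ = app (dayBraid _ _ ≫ dayMap g (𝟙 F)) _ _
    simp [app_res]
  braiding_naturality_left f G := day_hom_ext fun s t => by
    change app (dayMap f (𝟙 G) ≫ dayBraid _ _) _ _ = app (dayBraid _ _ ≫ dayMap (𝟙 G) f) _ _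
    simp [app_res]
  hexagon_forward F G H := day_hom_ext₃ fun {X Y Z} s t u => by
    change app ((dayAssoc F G H).hom ≫ dayBraid F (day G H) ≫ (dayAssoc G H F).hom) _ _ =
      app (dayMap (dayBraid F G) (𝟙 H) ≫ (dayAssoc G F H).hom ≫ dayMap (𝟙 G) (dayBraid F H)) _ _
    simp only [app_comp, dayMap_tm, dayAssoc_hom_tm, dayBraid_tm, app_id, app_res, tm_res_left,
      tm_res_right, ← res_comp]
    rw [BraidedCategory.hexagon_forward]
  hexagon_reverse F G H := day_hom_ext₃' fun {X Y Z} s t u => by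
    change app ((dayAssoc F G H).inv ≫ dayBraid (day F G) H ≫ (dayAssoc H F G).inv) _ _ =
      app (dayMap (𝟙 F) (dayBraid G H) ≫ (dayAssoc F H G).inv ≫ dayMap (dayBraid F H) (𝟙 G)) _ _
    simp only [app_comp, dayMap_tm, dayAssoc_inv_tm, dayBraid_tm, app_id, app_res, tm_res_left,
      tm_res_right, ← res_comp]
    rw [BraidedCategory.hexagon_reverse]
  symmetry F G := dayBraid_dayBraid F G

end Braiding

end Day

section Coalgebras

variable (k : Type u) [Field k] (C : Type u) [SmallCategory C] [Preadditive C] [Linear k C]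
  [MonoidalCategory C] [MonoidalPreadditive C] [MonoidalLinear k C] [SymmetricCategory C]

/-- The category of cocommutative, coassociative, counital coalgebra objects in the category of
`k`-linear presheaves on `C`, for the Day convolution product. -/
abbrev CoCAlg : Type (u + 1) := CommComon (LinPsh k C)

/-- The underlying functor from coalgebras to presheaves. -/
abbrev underlying : CoCAlg k C ⥤ LinPsh k C := CommComon.forget₂Comon _ ⋙ Comon.forget _

/-- The cardinality of a presheaf: the cardinality of the set of all its sections. -/
def pshCard {k : Type u} [Field k] {C : Type u} [SmallCategory C] [Preadditive C] [Linear k C]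
    (F : LinPsh k C) : Cardinal.{u} := Cardinal.mk (Σ X : C, Sec F X)

/-- The cardinality of a small category: the cardinality of the set of all its morphisms. -/
def catCard (C : Type u) [SmallCategory C] : Cardinal.{u} := Cardinal.mk (Σ X Y : C, X ⟶ Y)

/-- The coalgebras whose cardinality is at most `max(#C, ℵ₀)`. -/
def smallCoalgebras : ObjectProperty (CoCAlg k C) :=
  fun A => pshCard A.X ≤ max (catCard C) Cardinal.aleph0

end Coalgebras

end DayCoalg

end

/-! Write κ for max(#C, ℵ₀). Everything rests on one fact: each coalgebra A is the directed union of
subcoalgebras of cardinality at most κ. The obstacle is that ⊗ need not preserve injections. For a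
subpresheaf P of A the map P ⊗ P → A ⊗ A may have a kernel, and then Δ neither restricts to P in a
unique way nor visibly stays coassociative.

The cure is a countable closure process (`exists_step`, `exists_pureSub`). The functors X ↦ X ⊗ X
and X ↦ X ⊗ (X ⊗ X) preserve filtered colimits and keep the size at most κ (`pshCard_day_le`). Since
A is the filtered union of its small subpresheaves, a small P lies in a small Q such that Δ(P) is
contained in the image of Q ⊗ Q and such that the kernels of P ⊗ P → A ⊗ A and of P ⊗ (P ⊗ P) → A ⊗
(A ⊗ A) die in the powers of Q. The union of the sequence obtained by iteration has tensor square
and cube embedded in those of A, so Δ restricts to it and the axioms are inherited (`ofMono`).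

Colimits of coalgebras are computed on underlying presheaves (`exists_isColimit`), so A is the
colimit of its small subcoalgebras, and these form a strong generator. Coalgebras of bounded size
form a set up to isomorphism and epimorphisms are surjective, so the special adjoint functor theorem
gives the right adjoint of U. Comonadicity is then Beck's theorem, because split equalizers survive
tensor powers (`exists_isLimit_fork`). Finally, a coalgebra is λ-presentable when its underlying
presheaf is; a regular λ that serves a set of generators proves local presentability. -/

noncomputable section

set_option linter.unusedSectionVars false

/-! ### Commutative comonoids in a braided monoidal category -/

namespace CommComonoid

open Limits ComonObj

universe w v' u'

variable {D : Type u'} [Category.{v'} D] [MonoidalCategory D] [BraidedCategory D]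

variable (D) in
/-- The underlying object functor on commutative comonoids. -/
abbrev forget : CommComon D ⥤ D := CommComon.forget₂Comon D ⋙ Comon.forget D

/-- The morphism of underlying objects of a morphism of commutative comonoids. -/
def homOf {A B : CommComon D} (f : A ⟶ B) : A.X ⟶ B.X := f.hom.hom

@[simp] lemma homOf_id (A : CommComon D) : homOf (𝟙 A) = 𝟙 A.X := rfl

@[simp]
lemma homOf_comp {A B C : CommComon D} (f : A ⟶ B) (g : B ⟶ C) :
    homOf (f ≫ g) = homOf f ≫ homOf g := rfl

lemma hom_ext {A B : CommComon D} {f g : A ⟶ B} (h : homOf f = homOf g) : f = g :=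
  CommComon.hom_ext _ _ h

/-- A morphism of commutative comonoids, from a compatible morphism of underlying objects. -/
def homMk {A B : CommComon D} (f : A.X ⟶ B.X) (counit : f ≫ ε[B.X] = ε[A.X])
    (comul : f ≫ Δ[B.X] = Δ[A.X] ≫ (f ⊗ₘ f)) : A ⟶ B :=
  InducedCategory.homMk { hom := f, isComonHom_hom := { hom_counit := counit, hom_comul := comul } }

@[simp] lemma homOf_homMk {A B : CommComon D} (f : A.X ⟶ B.X) (counit : f ≫ ε[B.X] = ε[A.X])
    (comul : f ≫ Δ[B.X] = Δ[A.X] ≫ (f ⊗ₘ f)) : homOf (homMk f counit comul) = f := rfl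

lemma homOf_counit {A B : CommComon D} (f : A ⟶ B) : homOf f ≫ ε[B.X] = ε[A.X] :=
  IsComonHom.hom_counit f.hom.hom

lemma homOf_comul {A B : CommComon D} (f : A ⟶ B) :
    homOf f ≫ Δ[B.X] = Δ[A.X] ≫ (homOf f ⊗ₘ homOf f) :=
  IsComonHom.hom_comul f.hom.hom

lemma homOf_comul_assoc {A B : CommComon D} (f : A ⟶ B) {Z : D} (h : B.X ⊗ B.X ⟶ Z) :
    homOf f ≫ Δ[B.X] ≫ h = Δ[A.X] ≫ (homOf f ⊗ₘ homOf f) ≫ h := by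
  rw [← Category.assoc, homOf_comul, Category.assoc]

instance : (forget D).ReflectsIsomorphisms where
  reflects {A B} f hf := by
    have : IsIso (homOf f) := hf
    refine ⟨homMk (inv (homOf f)) ?_ ?_, hom_ext ?_, hom_ext ?_⟩
    · rw [IsIso.inv_comp_eq, homOf_counit]
    · rw [IsIso.inv_comp_eq, homOf_comul_assoc, tensorHom_comp_tensorHom, IsIso.hom_inv_id,
        id_tensorHom_id, Category.comp_id]
    · simp
    · simp

/-- A commutative comonoid from its structure morphisms. -/
def mk (X : D) (c : X ⟶ 𝟙_ D) (d : X ⟶ X ⊗ X) (counit_comul : d ≫ c ▷ X = (λ_ X).inv)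
    (assoc : d ≫ X ◁ d = d ≫ d ▷ X ≫ (α_ X X X).hom) (comm : d ≫ (β_ X X).hom = d) :
    CommComon D :=
  letI : ComonObj X :=
    { counit := c
      comul := d
      counit_comul := counit_comul
      comul_counit := by
        -- By commutativity the second counit law is the first one transported by the braiding.
        rw [← comm, Category.assoc, ← BraidedCategory.braiding_naturality_left,
          reassoc_of% counit_comul]
        simp
      comul_assoc := assoc }
  { X := X
    comm := ⟨comm⟩ }

section OfMono

variable (A : CommComon D) {E : D} (e : E ⟶ A.X) [Mono e] [Mono (e ⊗ₘ e)]
  [Mono (e ⊗ₘ (e ⊗ₘ e))] (d : E ⟶ E ⊗ E) (hd : d ≫ (e ⊗ₘ e) = e ≫ Δ[A.X])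

/-- The commutative comonoid structure on a subobject to which the comultiplication restricts. -/
def ofMono : CommComon D := mk E (e ≫ ε[A.X]) d
  (by
    have : Mono ((𝟙_ D) ◁ e) := by
      have h : (𝟙_ D) ◁ e = (λ_ E).hom ≫ e ≫ (λ_ A.X).inv := by simp
      rw [h]; infer_instance
    rw [← cancel_mono ((𝟙_ D) ◁ e), ← leftUnitor_inv_naturality, ← counit_comul A.X,
      ← reassoc_of% hd, Category.assoc, ← MonoidalCategory.tensorHom_def, ← tensorHom_id,
      tensorHom_comp_tensorHom, Category.comp_id])
  (by
    -- Coassociativity equates maps into E ⊗ (E ⊗ E), so it is tested after the inclusion of cubes;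
    -- this is the only use of its being mono.
    rw [← cancel_mono (e ⊗ₘ (e ⊗ₘ e))]
    have h₁ : d ≫ E ◁ d ≫ (e ⊗ₘ (e ⊗ₘ e)) = e ≫ Δ[A.X] ≫ A.X ◁ Δ[A.X] := by
      rw [← id_tensorHom, tensorHom_comp_tensorHom, hd, Category.id_comp,
        ← reassoc_of% hd, ← id_tensorHom, tensorHom_comp_tensorHom, Category.comp_id]
    have h₂ : d ≫ d ▷ E ≫ (α_ E E E).hom ≫ (e ⊗ₘ (e ⊗ₘ e)) =
        e ≫ Δ[A.X] ≫ Δ[A.X] ▷ A.X ≫ (α_ A.X A.X A.X).hom := by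
      rw [← associator_naturality, ← reassoc_of% hd, ← tensorHom_id, ← tensorHom_id,
        tensorHom_comp_tensorHom_assoc, tensorHom_comp_tensorHom_assoc, hd, Category.id_comp,
        Category.comp_id]
    simp only [Category.assoc]
    rw [h₁, h₂, comul_assoc])
  (by
    rw [← cancel_mono (e ⊗ₘ e), Category.assoc, ← BraidedCategory.braiding_naturality,
      reassoc_of% hd, IsCommComonObj.comul_comm, hd])

/-- The inclusion of a subcomonoid. -/
def ofMonoι : ofMono A e d hd ⟶ A := homMk (A := ofMono A e d hd) e rfl hd.symm

/-- A morphism of comonoids whose underlying morphism factors through a subcomonoid factors. -/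
def ofMonoLift {B : CommComon D} (f : B ⟶ A) (g : B.X ⟶ E) (hg : g ≫ e = homOf f) :
    B ⟶ ofMono A e d hd :=
  have h : g ≫ d = Δ[B.X] ≫ (g ⊗ₘ g) := by
    rw [← cancel_mono (e ⊗ₘ e), Category.assoc, Category.assoc, hd, reassoc_of% hg, homOf_comul,
      tensorHom_comp_tensorHom, hg]
  homMk (B := ofMono A e d hd) g
    (show g ≫ e ≫ ε[A.X] = _ by rw [reassoc_of% hg, homOf_counit]) h

lemma ofMonoLift_ι {B : CommComon D} (f : B ⟶ A) (g : B.X ⟶ E) (hg : g ≫ e = homOf f) :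
    ofMonoLift A e d hd f g hg ≫ ofMonoι A e d hd = f :=
  hom_ext hg

end OfMono

/-- Transport of the comonoid structure along an isomorphism. -/
def ofIso (A : CommComon D) {E : D} (e : E ≅ A.X) : CommComon D :=
  ofMono A e.hom (e.hom ≫ Δ[A.X] ≫ (e.inv ⊗ₘ e.inv)) (by simp)

/-- The transported comonoid is isomorphic to the original one. -/
def isoOfIso (A : CommComon D) {E : D} (e : E ≅ A.X) : ofIso A e ≅ A where
  hom := ofMonoι A e.hom _ _
  inv := ofMonoLift A e.hom _ _ (𝟙 A) e.inv (by simp)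
  hom_inv_id := hom_ext e.hom_inv_id
  inv_hom_id := hom_ext e.inv_hom_id

/-! ### Split equalizers and comonadicity -/

section Comonadic

variable {A B : CommComon D} (f g : A ⟶ B)

/-- Split equalizers are absolute. The equalizer e has a retraction, so its tensor powers are split
monomorphisms, and the splitting data show that Δ restricts along e. The resulting subcomonoid is
the equalizer both of comonoids and of underlying objects, as Beck's theorem requires. -/
lemma exists_isLimit_fork [(forget D).IsCosplitPair f g] :
    ∃ (c : Fork f g), Nonempty (IsLimit c) ∧ Nonempty (IsLimit ((forget D).mapCone c)) := by
  obtain ⟨E, e, ⟨h⟩⟩ := HasSplitEqualizer.splittable (f := (forget D).map f)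
    (g := (forget D).map g)
  -- Only the type changes: the codomain is now written `A.X`, so that `Δ[A.X]` and rewriting apply.
  obtain ⟨e, rfl⟩ : ∃ e' : E ⟶ A.X, e' = e := ⟨e, rfl⟩
  obtain ⟨s, hs⟩ : ∃ s : A.X ⟶ E, s = h.leftRetraction := ⟨_, rfl⟩
  obtain ⟨t, ht⟩ : ∃ t : B.X ⟶ A.X, t = h.rightRetraction := ⟨_, rfl⟩
  have h₁ : e ≫ s = 𝟙 E := hs ▸ h.ι_leftRetraction
  have h₂ : homOf f ≫ t = s ≫ e := hs ▸ ht ▸ h.top_rightRetraction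
  have h₃ : homOf g ≫ t = 𝟙 A.X := ht ▸ h.bottom_rightRetraction
  have h₄ : e ≫ homOf f = e ≫ homOf g := h.condition
  have he : IsSplitMono e := ⟨⟨s, h₁⟩⟩
  have he₂ : IsSplitMono (e ⊗ₘ e) := ⟨⟨s ⊗ₘ s, by simp [h₁]⟩⟩
  have he₃ : IsSplitMono (e ⊗ₘ (e ⊗ₘ e)) := ⟨⟨s ⊗ₘ (s ⊗ₘ s), by simp [h₁]⟩⟩
  -- As s ≫ e = f ≫ t, the left side is e ≫ f ≫ Δ ≫ (t ⊗ t). Replacing e ≫ f by e ≫ g and using g ≫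
  -- t = 𝟙 gives e ≫ Δ.
  have hd : (e ≫ Δ[A.X] ≫ (s ⊗ₘ s)) ≫ (e ⊗ₘ e) = e ≫ Δ[A.X] := by
    rw [Category.assoc, Category.assoc, tensorHom_comp_tensorHom, ← h₂,
      ← tensorHom_comp_tensorHom, ← homOf_comul_assoc, reassoc_of% h₄, homOf_comul_assoc,
      tensorHom_comp_tensorHom, h₃, id_tensorHom_id, Category.comp_id]
  refine ⟨Fork.ofι (ofMonoι A e _ hd) (hom_ext h₄), ⟨Fork.IsLimit.mk' _ fun c => ?_⟩, ⟨?_⟩⟩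
  · have hc : (homOf c.ι ≫ s) ≫ e = homOf c.ι := by
      have h : homOf c.ι ≫ homOf f = homOf c.ι ≫ homOf g := congrArg homOf c.condition
      rw [Category.assoc, ← h₂, reassoc_of% h, h₃, Category.comp_id]
    refine ⟨ofMonoLift A e _ hd c.ι _ hc, ofMonoLift_ι _ _ _ _ _ _ _, fun {m} hm => hom_ext ?_⟩
    have hm' : homOf m ≫ e = homOf c.ι := congrArg homOf hm
    exact (cancel_mono e).1 (hm'.trans hc.symm)
  · exact (isLimitMapConeForkEquiv (forget D) _).symm h.isEqualizer

variable (D) in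
/-- The forgetful functor from commutative comonoids is comonadic as soon as it has a right
adjoint. -/
lemma nonempty_comonadicLeftAdjoint [(forget D).IsLeftAdjoint] :
    Nonempty (ComonadicLeftAdjoint (forget D)) := by
  have : Comonad.HasEqualizerOfIsCosplitPair (forget D) := ⟨fun f g _ => by
    obtain ⟨c, ⟨hc⟩, -⟩ := exists_isLimit_fork f g
    exact ⟨⟨⟨c, hc⟩⟩⟩⟩
  have : Comonad.PreservesLimitOfIsCosplitPair (forget D) := ⟨fun f g _ => by
    obtain ⟨c, ⟨hc⟩, ⟨hc'⟩⟩ := exists_isLimit_fork f g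
    exact preservesLimit_of_preserves_limit_cone hc hc'⟩
  exact ⟨Comonad.comonadicOfHasPreservesFSplitEqualizersOfReflectsIsomorphisms
    (Adjunction.ofIsLeftAdjoint (forget D))⟩

end Comonadic

/-- The commutative comonoid structure on the target of a jointly epimorphic family of morphisms
from commutative comonoids with which structure morphisms are compatible. -/
def ofJointlyEpi {ι : Type*} (A : ι → CommComon D) {P : D} (i : ∀ j, (A j).X ⟶ P)
    (hi : ∀ {Z : D} {f g : P ⟶ Z}, (∀ j, i j ≫ f = i j ≫ g) → f = g)
    (c : P ⟶ 𝟙_ D) (d : P ⟶ P ⊗ P) (hc : ∀ j, i j ≫ c = ε[(A j).X])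
    (hd : ∀ j, i j ≫ d = Δ[(A j).X] ≫ (i j ⊗ₘ i j)) : CommComon D :=
  mk P c d
    (hi fun j => by
      rw [reassoc_of% hd j, ← tensorHom_id, tensorHom_comp_tensorHom, hc, Category.comp_id,
        counit_comul_hom])
    (hi fun j => by
      have h₁ : (i j ⊗ₘ Δ[(A j).X] ≫ (i j ⊗ₘ i j)) =
          (A j).X ◁ Δ ≫ (i j ⊗ₘ (i j ⊗ₘ i j)) := by
        rw [← id_tensorHom, tensorHom_comp_tensorHom, Category.id_comp]
      have h₂ : (Δ[(A j).X] ≫ (i j ⊗ₘ i j) ⊗ₘ i j) =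
          Δ ▷ (A j).X ≫ ((i j ⊗ₘ i j) ⊗ₘ i j) := by
        rw [← tensorHom_id, tensorHom_comp_tensorHom, Category.id_comp]
      rw [reassoc_of% hd j, reassoc_of% hd j, ← id_tensorHom, ← tensorHom_id,
        tensorHom_comp_tensorHom, tensorHom_comp_tensorHom_assoc, hd, Category.comp_id, h₁, h₂,
        Category.assoc, associator_naturality, comul_assoc_assoc])
    (hi fun j => by
      rw [reassoc_of% hd j, BraidedCategory.braiding_naturality, hd,
        IsCommComonObj.comul_comm_assoc])

/-! ### Colimits of comonoids -/

section Colimits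

variable {J : Type*} [Category* J] (F : J ⥤ CommComon D)

/-- The legs of the underlying colimit are jointly epimorphic, so the structure maps are induced
from those of the diagram and every axiom is checked on the legs. No compatibility of ⊗ with
colimits is needed. -/
lemma exists_isColimit {c : Cocone (F ⋙ forget D)} (hc : IsColimit c) :
    ∃ (c' : Cocone F), Nonempty (IsColimit c') ∧
      Nonempty (IsColimit ((forget D).mapCocone c')) := by
  obtain ⟨i, hi⟩ : ∃ i : ∀ j, (F.obj j).X ⟶ c.pt, i = c.ι.app := ⟨_, rfl⟩
  have w {j j' : J} (f : j ⟶ j') : homOf (F.map f) ≫ i j' = i j := hi ▸ c.w f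
  have epi {Z : D} {f g : c.pt ⟶ Z} (h : ∀ j, i j ≫ f = i j ≫ g) : f = g :=
    hc.hom_ext (hi ▸ h)
  have desc {Z : D} (s : ∀ j, (F.obj j).X ⟶ Z)
      (hs : ∀ {j j' : J} (f : j ⟶ j'), homOf (F.map f) ≫ s j' = s j) :
      ∃ m : c.pt ⟶ Z, ∀ j, i j ≫ m = s j :=
    ⟨hc.desc (Cocone.mk Z
      { app := s, naturality := fun _ _ f => (hs f).trans (Category.comp_id _).symm }),
      hi ▸ fun j => hc.fac _ j⟩
  obtain ⟨e, he⟩ := desc (fun j => ε[(F.obj j).X]) fun f => homOf_counit _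
  obtain ⟨d, hd⟩ := desc (fun j => Δ[(F.obj j).X] ≫ (i j ⊗ₘ i j)) fun f => by
    rw [homOf_comul_assoc, tensorHom_comp_tensorHom, w]
  let P : CommComon D := ofJointlyEpi F.obj i epi e d he hd
  let c' : Cocone F :=
    { pt := P
      ι :=
        { app := fun j => homMk (B := P) (i j) (he j) (hd j)
          naturality := fun j j' f => hom_ext ((w f).trans (Category.comp_id _).symm) } }
  refine ⟨c', ⟨?_⟩, ⟨hc.ofIsoColimit (Cocone.ext (Iso.refl _) fun j => ?_)⟩⟩
  · have key (s : Cocone F) : ∃ m : P ⟶ s.pt, ∀ j, i j ≫ homOf m = homOf (s.ι.app j) := by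
      obtain ⟨m, hm⟩ := desc (fun j => homOf (s.ι.app j)) fun f => congrArg homOf (s.w f)
      have h₁ : m ≫ ε[s.pt.X] = e := epi fun j => by
        rw [reassoc_of% hm j, homOf_counit, he]
      have h₂ : m ≫ Δ[s.pt.X] = d ≫ (m ⊗ₘ m) := epi fun j => by
        rw [reassoc_of% hm j, homOf_comul, reassoc_of% hd j, tensorHom_comp_tensorHom, hm]
      exact ⟨homMk (A := P) m h₁ h₂, hm⟩
    exact
      { desc := fun s => (key s).choose
        fac := fun s j => hom_ext ((key s).choose_spec j)
        uniq := fun s m hm => hom_ext (epi fun j =>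
          (congrArg homOf (hm j)).trans ((key s).choose_spec j).symm) }
  · rw [← hi]
    exact Category.comp_id _

instance [HasColimitsOfShape J D] : HasColimitsOfShape J (CommComon D) where
  has_colimit F := by
    obtain ⟨c, ⟨hc⟩, -⟩ := exists_isColimit F (colimit.isColimit (F ⋙ forget D))
    exact ⟨⟨⟨c, hc⟩⟩⟩

instance [HasColimitsOfShape J D] : PreservesColimitsOfShape J (forget D) where
  preservesColimit {F} := by
    obtain ⟨c, ⟨hc⟩, ⟨hc'⟩⟩ := exists_isColimit F (colimit.isColimit (F ⋙ forget D))
    exact preservesColimit_of_preserves_colimit_cocone hc hc'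

end Colimits

/-! ### Presentability of comonoids -/

section Presentable

variable (D) in
/-- The functor `X ↦ X ⊗ X`. -/
def square : D ⥤ D where
  obj X := X ⊗ X
  map f := f ⊗ₘ f

/-- A commutative comonoid is `κ`-presentable when its underlying object is. -/
lemma isCardinalPresentable (κ : Cardinal.{w}) [Fact κ.IsRegular] [HasColimitsOfSize.{w, w} D]
    [PreservesFilteredColimitsOfSize.{w, w} (square D)]
    (A : CommComon D) [IsCardinalPresentable A.X κ] : IsCardinalPresentable A κ where
  preservesColimitOfShape J _ _ := ⟨fun {K} => ⟨fun {c} hc => by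
    have := isFiltered_of_isCardinalFiltered J κ
    have hc₁ := isColimitOfPreserves (forget D) hc
    have hc₂ := isColimitOfPreserves (square D) hc₁
    have := isFiltered_of_isCardinalFiltered J κ
    have w {j j' : J} (u : j ⟶ j') :
        homOf (K.map u) ≫ homOf (c.ι.app j') = homOf (c.ι.app j) :=
      congrArg homOf (c.w u)
    have lift (f : A.X ⟶ c.pt.X) : ∃ (j : J) (f' : A.X ⟶ (K.obj j).X),
        f' ≫ homOf (c.ι.app j) = f := IsCardinalPresentable.exists_hom_of_isColimit κ hc₁ f
    have eq₁ {j : J} (f g : A.X ⟶ (K.obj j).X)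
        (h : f ≫ homOf (c.ι.app j) = g ≫ homOf (c.ι.app j)) :
        ∃ (j' : J) (a : j ⟶ j'), f ≫ homOf (K.map a) = g ≫ homOf (K.map a) :=
      IsCardinalPresentable.exists_eq_of_isColimit' κ hc₁ f g h
    have eq₂ {j : J} (f g : A.X ⟶ (K.obj j).X ⊗ (K.obj j).X)
        (h : f ≫ (homOf (c.ι.app j) ⊗ₘ homOf (c.ι.app j)) =
          g ≫ (homOf (c.ι.app j) ⊗ₘ homOf (c.ι.app j))) :
        ∃ (j' : J) (a : j ⟶ j'), f ≫ (homOf (K.map a) ⊗ₘ homOf (K.map a)) =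
          g ≫ (homOf (K.map a) ⊗ₘ homOf (K.map a)) :=
      IsCardinalPresentable.exists_eq_of_isColimit' κ hc₂ f g h
    refine ⟨Types.FilteredColimit.isColimitOf' _ _ (fun (f : A ⟶ c.pt) => ?_)
      (fun j (f : A ⟶ K.obj j) (g : A ⟶ K.obj j) hfg => ?_)⟩
    · obtain ⟨j, f', hf'⟩ := lift (homOf f)
      -- The lift f' need not respect Δ at stage j, but the two composites agree in the colimit of
      -- the squares, hence at a later stage.
      obtain ⟨j', a, ha⟩ := eq₂ (f' ≫ Δ) (Δ ≫ (f' ⊗ₘ f')) (by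
        rw [Category.assoc, Category.assoc, ← homOf_comul, reassoc_of% hf', homOf_comul,
          tensorHom_comp_tensorHom, hf'])
      refine ⟨j', homMk (f' ≫ homOf (K.map a)) ?_ ?_, hom_ext ?_⟩
      -- The counit needs no further stage: the counit of `K.obj j'` factors through that of the
      -- colimit.
      · rw [← homOf_counit (c.ι.app j'), Category.assoc, reassoc_of% w a, reassoc_of% hf',
          homOf_counit]
      · rw [Category.assoc, homOf_comul, ← Category.assoc, ha, Category.assoc,
          tensorHom_comp_tensorHom]
      · change homOf f = (f' ≫ homOf (K.map a)) ≫ homOf (c.ι.app j')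
        rw [Category.assoc, w, hf']
    · obtain ⟨j', a, ha⟩ := eq₁ (homOf f) (homOf g) (congrArg homOf hfg)
      exact ⟨j', a, hom_ext ha⟩⟩⟩

end Presentable

end CommComonoid

/-! ### Tensor powers and sifted colimits -/

namespace CommComonoid

open Limits

variable {D E J : Type*} [Category* D] [Category* E] [Category* J] [MonoidalCategory D]

/-- The functor `X ↦ G(X) ⊗ H(X)`. -/
def tensorFunctor (G H : E ⥤ D) : E ⥤ D where
  obj X := G.obj X ⊗ H.obj X
  map f := G.map f ⊗ₘ H.map f

/-- A bifunctor that preserves colimits in each variable sends a pair of colimits to a colimit over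
J × J, and for sifted J the diagonal J → J × J is final. -/
lemma preservesColimitsOfShape_tensorFunctor [IsSifted J] (G H : E ⥤ D)
    [PreservesColimitsOfShape J G] [PreservesColimitsOfShape J H]
    [∀ X : D, PreservesColimitsOfShape J (tensorLeft X)]
    [∀ X : D, PreservesColimitsOfShape J (tensorRight X)] :
    PreservesColimitsOfShape J (tensorFunctor G H) where
  preservesColimit {K} := ⟨fun {c} hc => by
    have (X : D) : PreservesColimitsOfShape J ((curriedTensor D).obj X) :=
      inferInstanceAs (PreservesColimitsOfShape J (tensorLeft X))
    have (X : D) : PreservesColimitsOfShape J ((curriedTensor D).flip.obj X) :=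
      inferInstanceAs (PreservesColimitsOfShape J (tensorRight X))
    have h := isColimitOfPreserves₂ (curriedTensor D) (isColimitOfPreserves G hc)
      (isColimitOfPreserves H hc)
    have h' := (Functor.Final.isColimitWhiskerEquiv (Functor.diag J) _).symm h
    let e : K ⋙ tensorFunctor G H ≅ Functor.diag J ⋙ Functor.uncurry.obj
        ((((Functor.whiskeringLeft₂ D).obj (K ⋙ G)).obj (K ⋙ H)).obj (curriedTensor D)) :=
      NatIso.ofComponents (fun j => Iso.refl _) fun f =>
        (Category.comp_id _).trans ((MonoidalCategory.tensorHom_def _ _).trans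
          (Category.id_comp _).symm)
    exact ⟨((IsColimit.precomposeHomEquiv e _).symm h').ofIsoColimit
      (Cocone.ext (Iso.refl _) fun j => (Category.comp_id _).trans
        ((Category.id_comp _).trans (MonoidalCategory.tensorHom_def _ _).symm))⟩⟩

variable [∀ X : D, PreservesColimitsOfShape J (tensorLeft X)]
    [∀ X : D, PreservesColimitsOfShape J (tensorRight X)] [IsSifted J]

instance : PreservesColimitsOfShape J (square D) :=
  preservesColimitsOfShape_tensorFunctor (𝟭 D) (𝟭 D)

variable (D) in
/-- The functor `X ↦ X ⊗ (X ⊗ X)`. -/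
abbrev cube : D ⥤ D := tensorFunctor (𝟭 D) (square D)

instance : PreservesColimitsOfShape J (cube D) :=
  preservesColimitsOfShape_tensorFunctor (𝟭 D) (square D)

end CommComonoid

namespace DayCoalg

open Limits

/-! ### Colimits and local presentability of linear presheaves -/

section Presheaves

variable {k : Type u} [Field k] {C : Type u} [SmallCategory C] [Preadditive C] [Linear k C]

/-- Colimits of presheaves are pointwise, and the legs over each object are jointly epimorphic, so
linearity is inherited from the diagram. -/
instance {J : Type*} [Category* J] [HasColimitsOfShape J (ModuleCat.{u} k)] :
    ObjectProperty.IsClosedUnderColimitsOfShape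
      (fun F : Cᵒᵖ ⥤ ModuleCat.{u} k => IsLinearPresheaf k C F) J where
  colimitsOfShape_le := by
    rintro F ⟨p⟩
    have h (X : Cᵒᵖ) {M : ModuleCat.{u} k} (f g : F.obj X ⟶ M)
        (h : ∀ j, (p.ι.app j).app X ≫ f = (p.ι.app j).app X ≫ g) : f = g :=
      (isColimitOfPreserves ((evaluation _ _).obj X) p.isColimit).hom_ext h
    have n (j : J) {X Y : Cᵒᵖ} (f : X ⟶ Y) :
        (p.ι.app j).app X ≫ F.map f = (p.diag.obj j).map f ≫ (p.ι.app j).app Y :=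
      ((p.ι.app j).naturality f).symm
    refine ⟨fun {X Y} f g => h _ _ _ fun j => ?_, fun {X Y} r f => h _ _ _ fun j => ?_⟩
    · rw [Preadditive.comp_add, n, n, n, (p.prop_diag_obj j).map_add, Preadditive.add_comp]
    · rw [Linear.comp_smul, n, n, (p.prop_diag_obj j).map_smul, Linear.smul_comp]

instance : HasColimitsOfSize.{u, u} (LinPsh k C) where
  has_colimits_of_shape _ _ := inferInstance

variable (k) in
/-- The functor of sections over an object. -/
abbrev secFunctor (X : C) : LinPsh k C ⥤ ModuleCat.{u} k :=
  ObjectProperty.ι _ ⋙ (evaluation _ _).obj (op X)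

instance (X : C) : PreservesColimitsOfSize.{u, u} (secFunctor k X) where
  preservesColimitsOfShape := inferInstance

/-- The Yoneda lemma: morphisms out of a representable presheaf are sections. -/
def repEquiv (A : C) (F : LinPsh k C) : (rep k A ⟶ F) ≃ Sec F A where
  toFun η := app η A (show Sec (rep k A) A from 𝟙 A)
  invFun s := mkHom (F := rep k A) (fun X => (resHom F X A).flip s)
    (fun f φ => res_comp F f (show _ ⟶ A from φ) s)
  left_inv η := psh_hom_ext fun X φ => by
    refine (app_res η (show X ⟶ A from φ) _).symm.trans ?_
    exact congrArg (app η X) (Category.comp_id (show X ⟶ A from φ))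
  right_inv s := res_id F A s

/-- The Yoneda lemma, as an isomorphism of functors. -/
def coyonedaRepIso (A : C) :
    coyoneda.obj (op (rep k A)) ≅ secFunctor k A ⋙ CategoryTheory.forget (ModuleCat.{u} k) :=
  NatIso.ofComponents (fun F => (repEquiv A F).toIso) fun _ => rfl

attribute [local instance] Cardinal.fact_isRegular_aleph0

/-- By Yoneda, mapping out of a representable is taking sections over an object, and this commutes
with filtered colimits. -/
instance isCardinalPresentable_rep (A : C) :
    IsCardinalPresentable (rep k A) Cardinal.aleph0.{u} := by
  have : (CategoryTheory.forget (ModuleCat.{u} k)).IsCardinalAccessible Cardinal.aleph0.{u} :=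
    ⟨fun J _ _ => by
      have := isFiltered_of_isCardinalFiltered J Cardinal.aleph0.{u}
      infer_instance⟩
  exact Functor.isCardinalAccessible_of_natIso (coyonedaRepIso A).symm _

lemma isIso_of_bijective {F G : LinPsh k C} (η : F ⟶ G)
    (h : ∀ X, Function.Bijective (app η X)) : IsIso η := by
  refine ⟨mkHom (fun X => (LinearEquiv.ofBijective (app η X) (h X)).symm.toLinearMap)
    (fun {X Y} f s => (h X).1 ?_), psh_hom_ext fun X s => ?_, psh_hom_ext fun X s => ?_⟩
  · rw [app_res]
    exact ((LinearEquiv.ofBijective (app η X) (h X)).apply_symm_apply _).trans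
      (congrArg (res G f) ((LinearEquiv.ofBijective (app η Y) (h Y)).apply_symm_apply s).symm)
  · exact (LinearEquiv.ofBijective (app η X) (h X)).symm_apply_apply s
  · exact (LinearEquiv.ofBijective (app η X) (h X)).apply_symm_apply s

lemma injective_of_mono {F G : LinPsh k C} (η : F ⟶ G) [Mono η] (X : C) :
    Function.Injective (app η X) := fun s t h => by
  obtain ⟨a, rfl⟩ := (repEquiv X F).surjective s
  obtain ⟨b, rfl⟩ := (repEquiv X F).surjective t
  have : a ≫ η = b ≫ η := (repEquiv X G).injective h
  rw [(cancel_mono η).1 this]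

lemma mono_of_injective {F G : LinPsh k C} (η : F ⟶ G) (h : ∀ X, Function.Injective (app η X)) :
    Mono η :=
  ⟨fun _ _ hab => psh_hom_ext fun X s => h X (congrArg (fun θ => app θ X s) hab)⟩

lemma surjective_of_epi {F G : LinPsh k C} (η : F ⟶ G) [Epi η] (X : C) :
    Function.Surjective (app η X) :=
  (ModuleCat.epi_iff_surjective _).1 (inferInstanceAs (Epi ((secFunctor k X).map η)))

instance isCardinalLocallyPresentable_linPsh :
    IsCardinalLocallyPresentable (LinPsh k C) Cardinal.aleph0.{u} := by
  rw [IsCardinalLocallyPresentable.iff_exists_isStrongGenerator]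
  refine ⟨.ofObj (rep k (C := C)), inferInstance, ?_, ?_⟩
  · rw [ObjectProperty.isStrongGenerator_iff]
    refine ⟨fun F G f g h => psh_hom_ext fun X s => ?_, fun F G i _ h => ?_⟩
    · obtain ⟨a, rfl⟩ := (repEquiv X F).surjective s
      exact congrArg (repEquiv X G) (h _ ⟨X⟩ a)
    · refine isIso_of_bijective i fun X => ⟨injective_of_mono i X, fun s => ?_⟩
      obtain ⟨a, rfl⟩ := (repEquiv X G).surjective s
      obtain ⟨b, rfl⟩ := h _ ⟨X⟩ a
      exact ⟨repEquiv X F b, rfl⟩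
  · rintro _ ⟨A⟩
    exact isCardinalPresentable_rep A

end Presheaves

/-! ### The Day product preserves colimits in each variable -/

section Tensor

variable {k : Type u} [Field k] {C : Type u} [SmallCategory C] [Preadditive C] [Linear k C]
  [MonoidalCategory C] [MonoidalPreadditive C] [MonoidalLinear k C]

/-- The morphism `s ↦ m(s ⊗ t)` obtained from `m : F ⊗ G ⟶ K` and a section `t` of `G`. -/
def curryRight {F G K : LinPsh k C} (m : day F G ⟶ K) {Y : C} (t : Sec G Y) : F ⟶ shiftR K Y :=
  mkHom (G := shiftR K Y)
    (fun X =>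
      { toFun := fun s => app m (X ⊗ Y) (tm s t)
        map_add' := fun s s' => by rw [tm_add_left, map_add]; rfl
        map_smul' := fun c s => by rw [tm_smul_left, map_smul]; rfl })
    (fun {X' X} f s => by
      change app m _ (tm (res F f s) t) = res K (f ▷ Y) (app m _ (tm s t))
      rw [tm_res_left, app_res])

/-- The morphism of shifted presheaves given by restriction. -/
def shiftRMap (K : LinPsh k C) {Y' Y : C} (β : Y' ⟶ Y) : shiftR K Y ⟶ shiftR K Y' :=
  mkHom (F := shiftR K Y) (G := shiftR K Y') (fun X => res K (X ◁ β))
    (fun {X' X} f (s : Sec K (X ⊗ Y)) => by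
    change res K _ (res K (f ▷ Y) s) = res K (f ▷ Y') (res K _ s)
    rw [← res_comp, ← res_comp, whisker_exchange])

/-- This replaces an internal hom. A section t of G over Y turns a map F ⊗ G ⟶ K into a map F ⟶ K(-
⊗ Y), which can be descended along the colimit one t at a time. Uniqueness of the descended maps
makes them linear and natural in t, so together they form a bilinear morphism. -/
lemma preservesColimitsOfShape_tensorRight (J : Type*) [Category* J] (G : LinPsh k C) :
    PreservesColimitsOfShape J (tensorRight G) where
  preservesColimit {K} := ⟨fun {c} hc => by
    have key (s : Cocone (K ⋙ tensorRight G)) : ∃ m : day c.pt G ⟶ s.pt,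
        ∀ (j : J) {X Y : C} (x : Sec (K.obj j) X) (t : Sec G Y),
          app m _ (tm (app (c.ι.app j) X x) t) =
            app (show day (K.obj j) G ⟶ s.pt from s.ι.app j) _ (tm x t) := by
      have h {Y : C} (t : Sec G Y) : ∃ b : c.pt ⟶ shiftR s.pt Y, ∀ (j : J),
          c.ι.app j ≫ b = curryRight (show day (K.obj j) G ⟶ s.pt from s.ι.app j) t := by
        refine ⟨hc.desc (Cocone.mk (shiftR s.pt Y)
          { app := fun j => curryRight (show day (K.obj j) G ⟶ s.pt from s.ι.app j) t
            naturality := fun i j f => ?_ }), fun j => hc.fac _ j⟩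
        refine (psh_hom_ext fun X x => ?_).trans (Category.comp_id _).symm
        change app (s.ι.app j) _ (tm (app (K.map f) X x) t) = app (s.ι.app i) _ (tm x t)
        rw [← s.w f]
        change _ = app (s.ι.app j) _ (app (dayMap (K.map f) (𝟙 G)) _ (tm x t))
        rw [dayMap_tm, app_id]
      choose b hb using @h
      have hb' (j : J) {X Y : C} (x : Sec (K.obj j) X) (t : Sec G Y) :
          app (b t) X (app (c.ι.app j) X x) =
            app (show day (K.obj j) G ⟶ s.pt from s.ι.app j) (X ⊗ Y) (tm x t) :=
        congrArg (fun θ => app θ X x) (hb t j)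
      have hadd {Y : C} (t t' : Sec G Y) : b (t + t') = b t + b t' := hc.hom_ext fun j => by
        refine psh_hom_ext fun X x => ?_
        refine (hb' j x (t + t')).trans ?_
        rw [tm_add_right, map_add]
        exact (congrArg₂ _ (hb' j x t) (hb' j x t')).symm
      have hsmul {Y : C} (r : k) (t : Sec G Y) : b (r • t) = r • b t := hc.hom_ext fun j => by
        refine psh_hom_ext fun X x => ?_
        refine (hb' j x (r • t)).trans ?_
        rw [tm_smul_right, map_smul]
        exact (congrArg (r • ·) (hb' j x t)).symm
      have hnat {Y Y' : C} (β : Y' ⟶ Y) (t : Sec G Y) :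
          b (res G β t) = b t ≫ shiftRMap s.pt β := hc.hom_ext fun j => by
        refine psh_hom_ext fun X x => ?_
        refine (hb' j x _).trans ?_
        rw [tm_res_right, app_res]
        exact (congrArg (res s.pt (X ◁ β)) (hb' j x t)).symm
      let B : Bihom c.pt G s.pt :=
        { toFun := fun {X Y} x t => app (b t) X x
          add_left := fun _ _ _ => map_add _ _ _
          smul_left := fun _ _ _ => map_smul _ _ _
          add_right := fun x t t' => by rw [hadd]; rfl
          smul_right := fun r x t => by rw [hsmul]; rfl
          nat := fun {X Y X' Y'} α β x t => by
            rw [hnat, MonoidalCategory.tensorHom_def']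
            exact (congrArg (res s.pt (X' ◁ β)) (app_res (b t) α x)).trans
              (res_comp s.pt _ _ _).symm }
      exact ⟨desc B, fun j X Y x t => (desc_tm B _ _).trans (hb' j x t)⟩
    choose m hm using key
    exact ⟨{ desc := m
             fac := fun s j => day_hom_ext fun {X Y} x t => by
              change app (m s) _ (app (dayMap (c.ι.app j) (𝟙 G)) _ (tm x t)) = _
              rw [dayMap_tm, app_id, hm]
             uniq := fun s m' hm' => day_hom_ext fun {X Y} x t => by
              have : curryRight m' t = curryRight (m s) t := hc.hom_ext fun j =>
                psh_hom_ext fun X x => by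
                  change app m' _ (tm (app (c.ι.app j) X x) t) =
                    app (m s) _ (tm (app (c.ι.app j) X x) t)
                  rw [hm, ← hm' j]
                  change _ = app m' _ (app (dayMap (c.ι.app j) (𝟙 G)) _ (tm x t))
                  rw [dayMap_tm, app_id]
              exact congrArg (fun θ => app θ X x) this }⟩⟩

variable [SymmetricCategory C]

instance (J : Type*) [Category* J] (G : LinPsh k C) :
    PreservesColimitsOfShape J (tensorRight G) :=
  preservesColimitsOfShape_tensorRight J G

instance (J : Type*) [Category* J] (G : LinPsh k C) :
    PreservesColimitsOfShape J (tensorLeft G) :=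
  preservesColimitsOfShape_of_natIso (BraidedCategory.tensorLeftIsoTensorRight G).symm

instance : PreservesFilteredColimitsOfSize.{u, u} (CommComonoid.square (LinPsh k C)) where
  preserves_filtered_colimits J _ _ :=
    have : IsSifted J := IsFiltered.isSifted
    inferInstance

instance : PreservesFilteredColimitsOfSize.{u, u} (CommComonoid.cube (LinPsh k C)) where
  preserves_filtered_colimits J _ _ :=
    have : IsSifted J := IsFiltered.isSifted
    inferInstance

end Tensor

end DayCoalg

namespace DayCoalg

open Limits CommComonoid

/-! ### Subpresheaves and filtered unions -/

section Sub

variable {k : Type u} [Field k] {C : Type u} [SmallCategory C] [Preadditive C] [Linear k C]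

/-- A subpresheaf of a linear presheaf. -/
@[ext]
structure SubPsh (F : LinPsh k C) where
  /-- The sections of the subpresheaf. -/
  carrier (X : C) : Submodule k (Sec F X)
  res_mem {X Y : C} (f : X ⟶ Y) {s : Sec F Y} (hs : s ∈ carrier Y) : res F f s ∈ carrier X

namespace SubPsh

variable {F : LinPsh k C}

instance : PartialOrder (SubPsh F) :=
  PartialOrder.lift carrier fun _ _ => SubPsh.ext

/-- A subpresheaf, as a presheaf. -/
def toPsh (P : SubPsh F) : LinPsh k C :=
  mkPsh (k := k) (fun X => P.carrier X) (fun f => (res F f).restrict fun _ hs => P.res_mem f hs)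
    (fun X s => Subtype.ext (res_id F X s))
    (fun f g s => Subtype.ext (res_comp F f g s))
    (fun f g s => Subtype.ext (res_add F f g s))
    (fun c f s => Subtype.ext (res_smul F c f s))

/-- The inclusion of a subpresheaf. -/
def incl (P : SubPsh F) : P.toPsh ⟶ F :=
  mkHom (F := P.toPsh) (fun X => (P.carrier X).subtype) fun _ _ => rfl

lemma incl_injective (P : SubPsh F) (X : C) : Function.Injective (app P.incl X) :=
  Subtype.val_injective

lemma app_incl_mem (P : SubPsh F) {X : C} (s : Sec P.toPsh X) : app P.incl X s ∈ P.carrier X :=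
  s.2

instance (P : SubPsh F) : Mono P.incl := mono_of_injective _ P.incl_injective

/-- The inclusion between two subpresheaves. -/
def ofLE {P Q : SubPsh F} (h : P ≤ Q) : P.toPsh ⟶ Q.toPsh :=
  mkHom (F := P.toPsh) (G := Q.toPsh) (fun X => Submodule.inclusion (h X)) fun _ _ => rfl

lemma ofLE_incl {P Q : SubPsh F} (h : P ≤ Q) : ofLE h ≫ Q.incl = P.incl := rfl

variable (F) in
/-- Subpresheaves, as a functor. -/
def functor : SubPsh F ⥤ LinPsh k C where
  obj P := P.toPsh
  map f := ofLE f.le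

/-- The subpresheaf generated by a set of sections. -/
def gen (S : Set (Σ X : C, Sec F X)) : SubPsh F where
  carrier X := Submodule.span k {s | ∃ t ∈ S, ∃ f : X ⟶ t.1, s = res F f t.2}
  res_mem {X Y} g s hs := by
    refine Submodule.span_induction (p := fun s _ => res F g s ∈ _) ?_ ?_ ?_ ?_ hs
    · rintro _ ⟨t, ht, f, rfl⟩
      exact Submodule.subset_span ⟨t, ht, g ≫ f, (res_comp F _ _ _).symm⟩
    · rw [map_zero]
      exact zero_mem _
    · intro s t _ _ hs ht
      rw [map_add]
      exact add_mem hs ht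
    · intro c s _ hs
      rw [map_smul]
      exact Submodule.smul_mem _ _ hs

lemma mem_gen {S : Set (Σ X : C, Sec F X)} {X : C} {s : Sec F X} (h : ⟨X, s⟩ ∈ S) :
    s ∈ (gen S).carrier X :=
  Submodule.subset_span ⟨_, h, 𝟙 X, (res_id F X s).symm⟩

/-- Scalars are absorbed into the morphisms, c • f^* t = (c • f)^* t, so plain sums of restrictions
suffice and the cardinality of k does not enter the bounds separately. -/
lemma exists_list_of_mem_gen {S : Set (Σ X : C, Sec F X)} {X : C} {s : Sec F X}
    (h : s ∈ (gen S).carrier X) :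
    ∃ l : List (Σ t : S, X ⟶ t.1.1), s = (l.map fun p => res F p.2 p.1.1.2).sum := by
  refine Submodule.span_induction (p := fun s _ => ∃ l : List (Σ t : S, X ⟶ t.1.1),
    s = (l.map fun p => res F p.2 p.1.1.2).sum) ?_ ?_ ?_ ?_ h
  · rintro _ ⟨t, ht, f, rfl⟩
    exact ⟨[⟨⟨t, ht⟩, f⟩], by simp⟩
  · exact ⟨[], rfl⟩
  · rintro _ _ _ _ ⟨l, rfl⟩ ⟨l', rfl⟩
    exact ⟨l ++ l', by simp⟩
  · rintro c _ _ ⟨l, rfl⟩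
    refine ⟨l.map fun p => ⟨p.1, c • p.2⟩, ?_⟩
    rw [List.smul_sum, List.map_map, List.map_map]
    congr 2
    exact funext fun p => (res_smul F c p.2 p.1.1.2).symm

/-- The union of an increasing sequence of subpresheaves. -/
def union (P : ℕ →o SubPsh F) : SubPsh F where
  carrier X := ⨆ n, (P n).carrier X
  res_mem {X Y} f s hs := by
    have hd (X : C) : Directed (· ≤ ·) fun n => (P n).carrier X :=
      Monotone.directed_le fun _ _ h => P.monotone h X
    obtain ⟨n, hn⟩ := (Submodule.mem_iSup_of_directed _ (hd Y)).1 hs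
    exact (Submodule.mem_iSup_of_directed _ (hd X)).2 ⟨n, (P n).res_mem f hn⟩

lemma mem_union {P : ℕ →o SubPsh F} {X : C} {s : Sec F X} :
    s ∈ (union P).carrier X ↔ ∃ n, s ∈ (P n).carrier X :=
  Submodule.mem_iSup_of_directed _ (Monotone.directed_le fun _ _ h => P.monotone h X)

lemma le_union (P : ℕ →o SubPsh F) (n : ℕ) : P n ≤ union P := fun _ _ hs => mem_union.2 ⟨n, hs⟩

end SubPsh

lemma exists_lift {F G H : LinPsh k C} (η : F ⟶ H) (m : G ⟶ H)
    (hm : ∀ X, Function.Injective (app m X)) (h : ∀ X (s : Sec F X), ∃ t, app m X t = app η X s) :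
    ∃ l : F ⟶ G, l ≫ m = η := by
  choose l hl using h
  exact ⟨mkHom
    (fun X =>
      { toFun := l X
        map_add' := fun s t => hm X (by simp only [hl, map_add])
        map_smul' := fun c s => hm X (by simp only [hl, map_smul, RingHom.id_apply]) })
    (fun {X Y} f s => hm X (by
      change app m X (l X _) = app m X (res G f (l Y s))
      rw [app_res, hl, hl, app_res])), psh_hom_ext hl⟩

section Filtered

variable {I : Type u} [SmallCategory I] [IsFiltered I] {D : I ⥤ LinPsh k C} (c : Cocone D)

/-- Filtered colimits of linear presheaves are detected on the sets of sections, where injective and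
jointly surjective legs suffice. -/
lemma nonempty_isColimit_of_injective (inj : ∀ i X, Function.Injective (app (c.ι.app i) X))
    (surj : ∀ X (s : Sec c.pt X), ∃ (i : I) (t : Sec (D.obj i) X), app (c.ι.app i) X t = s) :
    Nonempty (IsColimit c) := by
  refine ⟨isColimitOfReflects (ObjectProperty.ι _) (evaluationJointlyReflectsColimits _ fun X =>
    isColimitOfReflects (CategoryTheory.forget (ModuleCat.{u} k))
      (Types.FilteredColimit.isColimitOf' _ _ (fun s => ?_) fun i s t h => ?_))⟩
  · obtain ⟨i, t, h⟩ := surj X.unop s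
    exact ⟨i, t, h.symm⟩
  · exact ⟨i, 𝟙 i, congrArg _ (inj i X.unop h)⟩

variable {c} (hc : IsColimit c)

include hc in
lemma exists_rep_of_isColimit {X : C} (s : Sec c.pt X) :
    ∃ (i : I) (t : Sec (D.obj i) X), app (c.ι.app i) X t = s :=
  Types.jointly_surjective_of_isColimit
    (isColimitOfPreserves (secFunctor k X ⋙ CategoryTheory.forget (ModuleCat.{u} k)) hc) s

include hc in
lemma exists_map_eq_zero_of_isColimit {X : C} {i : I} (s : Sec (D.obj i) X)
    (h : app (c.ι.app i) X s = 0) : ∃ (j : I) (f : i ⟶ j), app (D.map f) X s = 0 := by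
  obtain ⟨j, f, hf⟩ := (Types.FilteredColimit.isColimit_eq_iff' (isColimitOfPreserves
    (secFunctor k X ⋙ CategoryTheory.forget (ModuleCat.{u} k)) hc) s (0 : Sec (D.obj i) X)).1
      (h.trans (map_zero (app (c.ι.app i) X)).symm)
  exact ⟨j, f, Eq.trans hf (map_zero (app (D.map f) X))⟩

end Filtered

end Sub

/-! ### Cardinality bounds and the enlargement of small subpresheaves -/

section Cardinality

open Cardinal

variable {k : Type u} [Field k] {C : Type u} [SmallCategory C] [Preadditive C] [Linear k C]
  {κ : Cardinal.{u}}

lemma mk_sigma_le {ι : Type u} {f : ι → Type u} (hκ : ℵ₀ ≤ κ) (hι : #ι ≤ κ)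
    (hf : ∀ i, #(f i) ≤ κ) : #(Σ i, f i) ≤ κ := by
  rw [mk_sigma]
  exact (sum_le_mk_mul_iSup _).trans
    ((mul_le_mul' hι (ciSup_le' hf)).trans (mul_eq_self hκ).le)

lemma mk_list_le {α : Type u} (hκ : ℵ₀ ≤ κ) (hα : #α ≤ κ) : #(List α) ≤ κ :=
  (mk_list_le_max α).trans (max_le hκ hα)

lemma mk_hom_le (hC : catCard C ≤ κ) (X Y : C) : #(X ⟶ Y) ≤ κ :=
  (mk_le_of_injective (f := fun f : X ⟶ Y => (⟨X, Y, f⟩ : Σ X Y : C, X ⟶ Y))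
    fun f g h => by simpa using h).trans hC

lemma mk_obj_le (hC : catCard C ≤ κ) : #C ≤ κ :=
  (mk_le_of_injective (f := fun X : C => (⟨X, X, 𝟙 X⟩ : Σ X Y : C, X ⟶ Y))
    fun _ _ h => congrArg Sigma.fst h).trans hC

lemma mk_sec_le {F : LinPsh k C} (hF : pshCard F ≤ κ) (X : C) : #(Sec F X) ≤ κ :=
  (mk_le_of_injective (f := fun s : Sec F X => (⟨X, s⟩ : Σ X : C, Sec F X))
    fun f g h => by simpa using h).trans hF

lemma pshCard_le {F : LinPsh k C} (hκ : ℵ₀ ≤ κ) (hC : catCard C ≤ κ) (hF : ∀ X, #(Sec F X) ≤ κ) :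
    pshCard F ≤ κ :=
  mk_sigma_le hκ (mk_obj_le hC) hF

/-- A section of F ⊗ G over U is a finite sum of classes φ ⊗ s ⊗ t, so lists of such triples, of
which there are at most κ, surject onto the sections. -/
lemma pshCard_day_le [MonoidalCategory C] {F G : LinPsh k C} (hκ : ℵ₀ ≤ κ) (hC : catCard C ≤ κ)
    (hF : pshCard F ≤ κ) (hG : pshCard G ≤ κ) : pshCard (day F G) ≤ κ := by
  refine pshCard_le hκ hC fun U => ?_
  let α := Σ (X : C) (Y : C) (_ : U ⟶ X ⊗ Y) (_ : Sec F X), Sec G Y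
  have hα : #α ≤ κ :=
    mk_sigma_le hκ (mk_obj_le hC) fun X => mk_sigma_le hκ (mk_obj_le hC) fun Y =>
      mk_sigma_le hκ (mk_hom_le hC _ _) fun _ => mk_sigma_le hκ (mk_sec_le hF _) fun _ =>
        mk_sec_le hG _
  refine (mk_le_of_surjective (f := fun l : List α => (l.map fun p =>
    (mk p.2.2.1 p.2.2.2.1 p.2.2.2.2 : DaySec F G U)).sum) fun z => ?_).trans (mk_list_le hκ hα)
  induction z using day_induction with
  | zero => exact ⟨[], rfl⟩
  | add z w hz hw =>
    obtain ⟨l, rfl⟩ := hz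
    obtain ⟨l', rfl⟩ := hw
    exact ⟨l ++ l', by simp⟩
  | pure φ s t => exact ⟨[⟨_, _, φ, s, t⟩], by simp⟩

namespace SubPsh

variable {F : LinPsh k C}

lemma pshCard_gen_le (hκ : ℵ₀ ≤ κ) (hC : catCard C ≤ κ) {S : Set (Σ X : C, Sec F X)}
    (hS : #S ≤ κ) : pshCard (gen S).toPsh ≤ κ := by
  refine pshCard_le hκ hC fun X => ?_
  refine le_trans ?_ (mk_list_le hκ (mk_sigma_le hκ hS fun t : S => mk_hom_le hC X t.1.1))
  have h (s : (gen S).carrier X) := exists_list_of_mem_gen s.2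
  choose l hl using h
  exact mk_le_of_injective (f := l) fun (s t : (gen S).carrier X) hst =>
    Subtype.ext (by rw [hl, hl, hst])

lemma pshCard_union_le (hκ : ℵ₀ ≤ κ) (hC : catCard C ≤ κ) (P : ℕ →o SubPsh F)
    (hP : ∀ n, pshCard (P n).toPsh ≤ κ) : pshCard (union P).toPsh ≤ κ := by
  refine pshCard_le hκ hC fun X => ?_
  have h₁ : #(Σ n : ULift.{u} ℕ, (P n.down).carrier X) ≤ κ :=
    mk_sigma_le hκ (by simpa using hκ) fun n => mk_sec_le (hP n.down) X
  refine le_trans ?_ h₁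
  refine mk_le_of_surjective (f := fun s => ⟨s.2.1, le_union P s.1.down X s.2.2⟩) fun s => ?_
  obtain ⟨n, hn⟩ := mem_union.1 s.2
  exact ⟨⟨⟨n⟩, ⟨s.1, hn⟩⟩, rfl⟩

lemma exists_upper_bound (hκ : ℵ₀ ≤ κ) (hC : catCard C ≤ κ) {ι : Type u} (hι : #ι ≤ κ)
    (P : ι → SubPsh F) (hP : ∀ i, pshCard (P i).toPsh ≤ κ) :
    ∃ Q : SubPsh F, pshCard Q.toPsh ≤ κ ∧ ∀ i, P i ≤ Q := by
  refine ⟨gen (Set.range fun p : Σ i, Σ X, (P i).carrier X => ⟨p.2.1, p.2.2.1⟩),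
    pshCard_gen_le hκ hC (mk_range_le.trans (mk_sigma_le hκ hι hP)), fun i X s hs => ?_⟩
  exact mem_gen ⟨⟨i, X, ⟨s, hs⟩⟩, rfl⟩

lemma exists_upper_bound₂ (hκ : ℵ₀ ≤ κ) (hC : catCard C ≤ κ) (P Q : SubPsh F)
    (hP : pshCard P.toPsh ≤ κ) (hQ : pshCard Q.toPsh ≤ κ) :
    ∃ R : SubPsh F, pshCard R.toPsh ≤ κ ∧ P ≤ R ∧ Q ≤ R := by
  obtain ⟨R, hR, h⟩ := exists_upper_bound hκ hC (ι := ULift.{u} Bool)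
    ((mk_le_aleph0).trans hκ) (fun b => bif b.down then P else Q)
    (by rintro ⟨_ | _⟩ <;> assumption)
  exact ⟨R, hR, h ⟨true⟩, h ⟨false⟩⟩

/-- The partially ordered set of the subpresheaves of cardinality at most `κ`. -/
abbrev SmallSub (κ : Cardinal.{u}) (F : LinPsh k C) : Type u :=
  {P : SubPsh F // pshCard P.toPsh ≤ κ}

/-- A presheaf is the union of its subpresheaves of cardinality at most `κ`. -/
def smallSubCocone : Cocone ((Subtype.mono_coe _).functor ⋙ functor F : SmallSub κ F ⥤ _) where
  pt := F
  ι := { app := fun P => P.1.incl }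

lemma isFiltered_smallSub (hκ : ℵ₀ ≤ κ) (hC : catCard C ≤ κ) : IsFiltered (SmallSub κ F) := by
  have : Nonempty (SmallSub κ F) := ⟨gen ∅, pshCard_gen_le hκ hC (by simp)⟩
  have : IsDirectedOrder (SmallSub κ F) := ⟨fun P Q => by
    obtain ⟨R, hR, h₁, h₂⟩ := exists_upper_bound₂ hκ hC P.1 Q.1 P.2 Q.2
    exact ⟨⟨R, hR⟩, h₁, h₂⟩⟩
  infer_instance

lemma nonempty_isColimit_smallSubCocone (hκ : ℵ₀ ≤ κ) (hC : catCard C ≤ κ) :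
    Nonempty (IsColimit (smallSubCocone (F := F) (κ := κ))) := by
  have := isFiltered_smallSub (F := F) hκ hC
  refine nonempty_isColimit_of_injective _ (fun P => P.1.incl_injective) fun X s => ?_
  have h : #({⟨X, s⟩} : Set (Σ X : C, Sec F X)) ≤ κ := by
    rw [mk_singleton]
    exact one_le_aleph0.trans hκ
  exact ⟨⟨gen {⟨X, s⟩}, pshCard_gen_le hκ hC h⟩, ⟨s, mem_gen rfl⟩, rfl⟩

variable (T : LinPsh k C ⥤ LinPsh k C)
  [PreservesFilteredColimitsOfSize.{u, u} T]

/-- F is the filtered colimit of its small subpresheaves and T preserves it, so each section of T(P)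
that dies in T(F) already dies in T(R) for some small R. There are at most κ sections, hence one
small Q serves them all. -/
lemma exists_small_of_map_eq_zero (hκ : ℵ₀ ≤ κ) (hC : catCard C ≤ κ) (P : SubPsh F)
    (hP : pshCard P.toPsh ≤ κ) (hT : pshCard (T.obj P.toPsh) ≤ κ) :
    ∃ (Q : SubPsh F) (h : P ≤ Q), pshCard Q.toPsh ≤ κ ∧ ∀ (X : C) (z : Sec (T.obj P.toPsh) X),
      app (T.map P.incl) X z = 0 → app (T.map (ofLE h)) X z = 0 := by
  have := isFiltered_smallSub (F := F) hκ hC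
  obtain ⟨hc⟩ := nonempty_isColimit_smallSubCocone (F := F) hκ hC
  have key (p : Σ X : C, Sec (T.obj P.toPsh) X) : ∃ (Q : SubPsh F) (h : P ≤ Q),
      pshCard Q.toPsh ≤ κ ∧ (app (T.map P.incl) p.1 p.2 = 0 →
        app (T.map (ofLE h)) p.1 p.2 = 0) := by
    by_cases h : app (T.map P.incl) p.1 p.2 = 0
    · obtain ⟨Q, f, hf⟩ := exists_map_eq_zero_of_isColimit (isColimitOfPreserves T hc)
        (i := ⟨P, hP⟩) p.2 h
      exact ⟨Q.1, f.le, Q.2, fun _ => hf⟩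
    -- A section that does not die imposes no condition; P is a default value.
    · exact ⟨P, le_rfl, hP, fun h' => absurd h' h⟩
  choose R hPR hR hR' using key
  obtain ⟨Q₀, hQ₀, hRQ₀⟩ := exists_upper_bound hκ hC hT R hR
  obtain ⟨Q, hQ, hPQ, hQ₀Q⟩ := exists_upper_bound₂ hκ hC P Q₀ hP hQ₀
  refine ⟨Q, hPQ, hQ, fun X z hz => ?_⟩
  have h : ofLE hPQ = ofLE (hPR ⟨X, z⟩) ≫ ofLE ((hRQ₀ ⟨X, z⟩).trans hQ₀Q) := rfl
  rw [h, T.map_comp, app_comp, hR' ⟨X, z⟩ hz, map_zero]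

/-- Every section of T(F) comes from T(R) with R small. Collecting such R for the at most κ values
of d on P gives Q. -/
lemma exists_small_rep (hκ : ℵ₀ ≤ κ) (hC : catCard C ≤ κ) (P : SubPsh F)
    (hP : pshCard P.toPsh ≤ κ) (d : F ⟶ T.obj F) :
    ∃ (Q : SubPsh F), pshCard Q.toPsh ≤ κ ∧ ∀ (X : C), ∀ s ∈ P.carrier X,
      ∃ z, app (T.map Q.incl) X z = app d X s := by
  have := isFiltered_smallSub (F := F) hκ hC
  obtain ⟨hc⟩ := nonempty_isColimit_smallSubCocone (F := F) hκ hC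
  have key (p : Σ X : C, P.carrier X) : ∃ (Q : SubPsh F), pshCard Q.toPsh ≤ κ ∧
      ∃ z, app (T.map Q.incl) p.1 z = app d p.1 p.2.1 := by
    obtain ⟨Q, z, hz⟩ := exists_rep_of_isColimit (isColimitOfPreserves T hc) (app d p.1 p.2.1)
    exact ⟨Q.1, Q.2, z, hz⟩
  choose R hR hR' using key
  obtain ⟨Q, hQ, hRQ⟩ := exists_upper_bound hκ hC hP R hR
  have key (p : Σ X : C, P.carrier X) : ∃ z, app (T.map Q.incl) p.1 z = app d p.1 p.2.1 := by
    have hle : R p ≤ Q := hRQ p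
    obtain ⟨z, hz⟩ := hR' p
    refine ⟨app (T.map (ofLE hle)) p.1 z, ?_⟩
    rw [← app_comp, ← T.map_comp, ofLE_incl, hz]
  exact ⟨Q, hQ, fun X s hs => key ⟨X, s, hs⟩⟩

lemma exists_rep_union (P : ℕ →o SubPsh F) {X : C} (z : Sec (T.obj (union P).toPsh) X) :
    ∃ (n : ℕ) (w : Sec (T.obj (P n).toPsh) X), app (T.map (ofLE (le_union P n))) X w = z := by
  -- The range of the sequence, instead of ℕ, is the index set, since it lives in the universe `u`
  -- of the colimits that T preserves.
  let I : Type u := {Q : SubPsh F // ∃ n, P n = Q}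
  have : Nonempty I := ⟨_, 0, rfl⟩
  have : IsDirectedOrder I := ⟨by
    rintro ⟨_, m, rfl⟩ ⟨_, n, rfl⟩
    exact ⟨⟨_, max m n, rfl⟩, P.monotone (le_max_left m n), P.monotone (le_max_right m n)⟩⟩
  have le (Q : I) : Q.1 ≤ union P := by
    obtain ⟨_, n, rfl⟩ := Q
    exact le_union P n
  let c : Cocone ((Subtype.mono_coe _).functor ⋙ functor F : I ⥤ _) :=
    { pt := (union P).toPsh
      ι := { app := fun Q => ofLE (le Q) } }
  obtain ⟨hc⟩ : Nonempty (IsColimit c) := by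
    refine nonempty_isColimit_of_injective _
      (fun Q X => Submodule.inclusion_injective (le Q X)) fun X s => ?_
    obtain ⟨n, hn⟩ := mem_union.1 (app_incl_mem _ s)
    exact ⟨⟨_, n, rfl⟩, ⟨_, hn⟩, rfl⟩
  obtain ⟨⟨_, n, rfl⟩, w, hw⟩ := exists_rep_of_isColimit (isColimitOfPreserves T hc) z
  exact ⟨n, w, hw⟩

end SubPsh

end Cardinality

end DayCoalg

/-! ### Essential smallness of classes of bounded size -/

namespace CommComonoid

open Limits

/-- The comonoid structures on a fixed object form a set, and every structure can be transported to
a chosen representative of its underlying object. -/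
lemma essentiallySmall_of_exists_iso {D : Type*} [Category.{u} D] [MonoidalCategory D]
    [BraidedCategory D] (P : ObjectProperty (CommComon D)) {ι : Type u} (E : ι → D)
    (h : ∀ A, P A → ∃ i, Nonempty (E i ≅ A.X)) : ObjectProperty.EssentiallySmall.{u} P where
  exists_small_le' := by
    let α : Type u := Σ (i : ι) (_ : ComonObj (E i)), PLift (IsCommComonObj (E i))
    let B (a : α) : CommComon D := { X := E a.1, comon := a.2.1, comm := a.2.2.down }
    refine ⟨.ofObj B, inferInstance, fun A hA => ?_⟩
    obtain ⟨i, ⟨e⟩⟩ := h A hA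
    let a : α := ⟨i, (ofIso A e).comon, ⟨(ofIso A e).comm⟩⟩
    exact ⟨B a, ⟨a⟩, ⟨(show B a ≅ A from isoOfIso A e).symm⟩⟩

end CommComonoid

namespace DayCoalg

open Limits CommComonoid Cardinal

section EssentiallySmall

variable {k : Type u} [Field k] {C : Type u} [SmallCategory C] [Preadditive C] [Linear k C]

variable (k C) in
/-- The data of a linear presheaf whose sets of sections are subsets of a fixed set. -/
structure PshData (K : Type u) : Type u where
  /-- The sets of sections. -/
  sec : C → Set K
  [addCommGroup : ∀ X, AddCommGroup (sec X)]
  [module : ∀ X, Module k (sec X)]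
  /-- The restriction maps. -/
  map : ∀ {X Y : C}, (X ⟶ Y) → sec Y →ₗ[k] sec X
  map_id : ∀ (X : C) (s : sec X), map (𝟙 X) s = s
  map_comp : ∀ {X Y Z : C} (f : X ⟶ Y) (g : Y ⟶ Z) (s : sec Z), map (f ≫ g) s = map f (map g s)
  map_add : ∀ {X Y : C} (f g : X ⟶ Y) (s : sec Y), map (f + g) s = map f s + map g s
  map_smul : ∀ {X Y : C} (c : k) (f : X ⟶ Y) (s : sec Y), map (c • f) s = c • map f s

attribute [instance] PshData.addCommGroup PshData.module

/-- The presheaf given by its data. -/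
def PshData.toPsh {K : Type u} (d : PshData k C K) : LinPsh k C :=
  mkPsh (k := k) (fun X => d.sec X) d.map d.map_id d.map_comp d.map_add d.map_smul

lemma exists_pshData {K : Type u} (F : LinPsh k C) (hF : ∀ X, #(Sec F X) ≤ #K) :
    ∃ d : PshData k C K, Nonempty (d.toPsh ≅ F) := by
  let j (X : C) : Sec F X ↪ K := Nonempty.some (hF X)
  let S (X : C) : Set K := Set.range (j X)
  -- The module structure and the restrictions are transported to the image of F(X) in K.
  let e (X : C) : S X ≃ Sec F X := (Equiv.ofInjective (j X) (j X).injective).symm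
  let _ (X : C) : AddCommGroup (S X) := (e X).addCommGroup
  let _ (X : C) : Module k (S X) := (e X).module k
  let E (X : C) : S X ≃ₗ[k] Sec F X := (e X).linearEquiv k
  let d : PshData k C K :=
    { sec := S
      map := fun {X Y} f => (E X).symm.toLinearMap ∘ₗ res F f ∘ₗ (E Y).toLinearMap
      map_id := fun X s => by simp
      map_comp := fun f g s => by simp [res_comp]
      map_add := fun f g s => by simp [res_add]
      map_smul := fun c f s => by simp [res_smul] }
  let η : d.toPsh ⟶ F := mkHom (F := d.toPsh) (fun X => (E X).toLinearMap)
    fun {X Y} f s => (E X).apply_symm_apply _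
  have := isIso_of_bijective η fun X => (E X).bijective
  exact ⟨d, ⟨asIso η⟩⟩

end EssentiallySmall

/-! ### Quotients and small subcoalgebras of a coalgebra -/

section Coalgebras

variable {k : Type u} [Field k] {C : Type u} [SmallCategory C] [Preadditive C] [Linear k C]
  [MonoidalCategory C] [MonoidalPreadditive C] [MonoidalLinear k C] [SymmetricCategory C]

lemma essentiallySmall_of_mk_sec_le (P : ObjectProperty (CoCAlg k C)) (κ : Cardinal.{u})
    (h : ∀ A, P A → ∀ X, #(Sec A.X X) ≤ κ) : ObjectProperty.EssentiallySmall.{u} P :=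
  essentiallySmall_of_exists_iso P (fun d : PshData k C κ.out => d.toPsh) fun A hA =>
    exists_pshData A.X fun X => (h A hA X).trans κ.mk_out.ge

lemma essentiallySmall_smallCoalgebras :
    ObjectProperty.EssentiallySmall.{u} (smallCoalgebras k C) :=
  essentiallySmall_of_mk_sec_le _ (max (catCard C) ℵ₀) fun _ hA X => mk_sec_le hA X

/-- The underlying functor preserves colimits, hence epimorphisms, so a quotient of A is surjective
on sections and no larger than A. This well-copoweredness is needed for the adjoint functor theorem.
-/
instance wellPowered_op_coCAlg : WellPowered.{u} (CoCAlg k C)ᵒᵖ where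
  subobject_small := fun A => by
    obtain ⟨Q, _, hQ⟩ := (essentiallySmall_of_mk_sec_le
      (fun B : CoCAlg k C => ∀ X, #(Sec B.X X) ≤ pshCard A.unop.X) _ fun _ h => h).exists_small_le'
    refine small_of_surjective (α := Σ q : Subtype Q, {f : A.unop ⟶ q.1 // Epi f})
      (f := fun q => have := q.2.2; Subobject.mk q.2.1.op) fun S => ?_
    obtain ⟨B, f, _, rfl⟩ : ∃ (B : CoCAlg k C) (f : A.unop ⟶ B) (_ : Epi f),
        S = Subobject.mk f.op := ⟨_, S.arrow.unop, inferInstance, (Subobject.mk_arrow S).symm⟩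
    have hf : Epi (homOf f) := inferInstanceAs (Epi ((underlying k C).map f))
    obtain ⟨B', hB', ⟨e⟩⟩ := hQ B fun X =>
      (mk_le_of_surjective (surjective_of_epi (homOf f) X)).trans (mk_sec_le le_rfl X)
    refine ⟨⟨⟨B', hB'⟩, f ≫ e.hom, inferInstance⟩, ?_⟩
    exact Subobject.mk_eq_mk_of_comm _ _ e.op (by simp)

section SmallSubcoalgebras

variable (A : CoCAlg k C)

/-- The subpresheaves of a coalgebra which are subcoalgebras, remain subobjects after taking tensor
powers, and are of cardinality at most `κ`. -/
structure PureSub (κ : Cardinal.{u}) : Type u where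
  /-- The underlying subpresheaf. -/
  sub : SubPsh A.X
  pshCard_le : pshCard sub.toPsh ≤ κ
  mono₂ : Mono (sub.incl ⊗ₘ sub.incl)
  mono₃ : Mono (sub.incl ⊗ₘ (sub.incl ⊗ₘ sub.incl))
  /-- The comultiplication. -/
  comul : sub.toPsh ⟶ sub.toPsh ⊗ sub.toPsh
  comul_incl : comul ≫ (sub.incl ⊗ₘ sub.incl) = sub.incl ≫ ComonObj.comul

attribute [instance] PureSub.mono₂ PureSub.mono₃

variable {A}

/-- One stage of the closure process: Q bounds the three enlargements of P that receive Δ(P), kill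
the kernel on squares and kill the kernel on cubes. Each property persists on enlarging Q. -/
lemma exists_step {κ : Cardinal.{u}} (hκ : ℵ₀ ≤ κ) (hC : catCard C ≤ κ) (P : SubPsh A.X)
    (hP : pshCard P.toPsh ≤ κ) : ∃ (Q : SubPsh A.X) (h : P ≤ Q), pshCard Q.toPsh ≤ κ ∧
      (∀ (X : C), ∀ s ∈ P.carrier X, ∃ z, app ((square _).map Q.incl) X z =
        app (ComonObj.comul (X := A.X)) X s) ∧
      (∀ (X : C) (z : Sec ((square _).obj P.toPsh) X),
        app ((square _).map P.incl) X z = 0 → app ((square _).map (SubPsh.ofLE h)) X z = 0) ∧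
      (∀ (X : C) (z : Sec ((cube _).obj P.toPsh) X),
        app ((cube _).map P.incl) X z = 0 → app ((cube _).map (SubPsh.ofLE h)) X z = 0) := by
  have hPP := pshCard_day_le hκ hC hP hP
  obtain ⟨Q₁, hQ₁, h₁⟩ := P.exists_small_rep (square _) hκ hC hP (ComonObj.comul (X := A.X))
  obtain ⟨Q₂, hPQ₂, hQ₂, h₂⟩ := P.exists_small_of_map_eq_zero (square _) hκ hC hP hPP
  obtain ⟨Q₃, hPQ₃, hQ₃, h₃⟩ := P.exists_small_of_map_eq_zero (cube _) hκ hC hP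
    (pshCard_day_le hκ hC hP hPP)
  obtain ⟨R, hR, h₁R, h₂R⟩ := SubPsh.exists_upper_bound₂ hκ hC Q₁ Q₂ hQ₁ hQ₂
  obtain ⟨Q, hQ, hRQ, h₃Q⟩ := SubPsh.exists_upper_bound₂ hκ hC R Q₃ hR hQ₃
  refine ⟨Q, hPQ₃.trans h₃Q, hQ, fun X s hs => ?_, fun X z hz => ?_, fun X z hz => ?_⟩
  · obtain ⟨z, hz⟩ := h₁ X s hs
    refine ⟨app ((square _).map (SubPsh.ofLE (h₁R.trans hRQ))) X z, ?_⟩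
    rw [← app_comp, ← Functor.map_comp, SubPsh.ofLE_incl]
    exact hz
  · have h : SubPsh.ofLE (hPQ₃.trans h₃Q) = SubPsh.ofLE hPQ₂ ≫ SubPsh.ofLE (h₂R.trans hRQ) := rfl
    rw [h, Functor.map_comp, app_comp, h₂ X z hz, map_zero]
  · have h : SubPsh.ofLE (hPQ₃.trans h₃Q) = SubPsh.ofLE hPQ₃ ≫ SubPsh.ofLE h₃Q := rfl
    rw [h, Functor.map_comp, app_comp, h₃ X z hz, map_zero]

/-- A section of T of the union comes from some T(P n). If it vanishes in T(F), it already vanishes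
in T(P (n + 1)), hence in T of the union. -/
lemma mono_map_incl_union (T : LinPsh k C ⥤ LinPsh k C)
    [PreservesFilteredColimitsOfSize.{u, u} T]
    {F : LinPsh k C} (P : ℕ →o SubPsh F)
    (h : ∀ n X (z : Sec (T.obj (P n).toPsh) X), app (T.map (P n).incl) X z = 0 →
      app (T.map (SubPsh.ofLE (P.monotone n.le_succ))) X z = 0) :
    Mono (T.map (SubPsh.union P).incl) := by
  refine mono_of_injective _ fun X => (injective_iff_map_eq_zero _).2 fun z hz => ?_
  obtain ⟨n, w, rfl⟩ := SubPsh.exists_rep_union T P z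
  rw [← app_comp, ← Functor.map_comp, SubPsh.ofLE_incl] at hz
  have h' : SubPsh.ofLE (SubPsh.le_union P n) =
    SubPsh.ofLE (P.monotone n.le_succ) ≫ SubPsh.ofLE (SubPsh.le_union P (n + 1)) := rfl
  rw [h', Functor.map_comp, app_comp, h n X w hz, map_zero]

/-- Iterating `exists_step` countably often and taking the union makes the inclusions of squares and
cubes mono, which no single stage guarantees. -/
lemma exists_pureSub {κ : Cardinal.{u}} (hκ : ℵ₀ ≤ κ) (hC : catCard C ≤ κ) (P : SubPsh A.X)
    (hP : pshCard P.toPsh ≤ κ) : ∃ Q : PureSub A κ, P ≤ Q.sub := by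
  choose N hN hN' h₁ h₂ h₃ using fun P : SubPsh.SmallSub κ A.X => exists_step hκ hC P.1 P.2
  let p (n : ℕ) : SubPsh.SmallSub κ A.X := n.rec ⟨P, hP⟩ fun _ Q => ⟨N Q, hN' Q⟩
  let p' : ℕ →o SubPsh A.X := ⟨fun n => (p n).1, monotone_nat_of_le_succ fun n => hN (p n)⟩
  have m₂ : Mono ((square _).map (SubPsh.union p').incl) :=
    mono_map_incl_union _ p' fun n => h₂ (p n)
  have m₃ : Mono ((cube _).map (SubPsh.union p').incl) :=
    mono_map_incl_union _ p' fun n => h₃ (p n)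
  -- A section of the union lies in stage n, and its comultiple is in the image of the square of
  -- stage n + 1. Injectivity on squares makes these choices a morphism.
  obtain ⟨d, hd⟩ := exists_lift ((SubPsh.union p').incl ≫ ComonObj.comul (X := A.X))
    ((square _).map (SubPsh.union p').incl) (@injective_of_mono _ _ _ _ _ _ _ _ _ m₂) fun X s => by
      obtain ⟨n, hn⟩ := SubPsh.mem_union.1 (SubPsh.app_incl_mem _ s)
      obtain ⟨z, hz⟩ := h₁ (p n) X _ hn
      refine ⟨app ((square _).map (SubPsh.ofLE (SubPsh.le_union p' (n + 1)))) X z, ?_⟩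
      have h := (square (LinPsh k C)).map_comp (SubPsh.ofLE (SubPsh.le_union p' (n + 1)))
        (SubPsh.union p').incl
      exact (congrArg (fun f => app f X z) h.symm).trans hz
  exact ⟨⟨SubPsh.union p', SubPsh.pshCard_union_le hκ hC p' fun n => (p n).2, m₂, m₃, d, hd⟩,
    SubPsh.le_union p' 0⟩

namespace PureSub

variable {κ : Cardinal.{u}}

instance : Preorder (PureSub A κ) := Preorder.lift sub

/-- The coalgebra structure on a pure subcoalgebra. -/
def obj (P : PureSub A κ) : CoCAlg k C := ofMono A P.sub.incl P.comul P.comul_incl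

/-- The inclusion of a pure subcoalgebra. -/
def ι (P : PureSub A κ) : P.obj ⟶ A := ofMonoι A P.sub.incl P.comul P.comul_incl

variable (A κ) in
/-- The diagram of pure subcoalgebras. -/
def diagram : PureSub A κ ⥤ CoCAlg k C where
  obj P := P.obj
  map {P Q} f := ofMonoLift A Q.sub.incl Q.comul Q.comul_incl P.ι (SubPsh.ofLE f.le) rfl
  map_id _ := CommComonoid.hom_ext rfl
  map_comp _ _ := CommComonoid.hom_ext rfl

variable (A κ) in
/-- The cocone of pure subcoalgebras. -/
def cocone : Cocone (diagram A κ) where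
  pt := A
  ι :=
    { app := fun P => P.ι
      naturality := fun _ _ _ => CommComonoid.hom_ext rfl }

lemma isFiltered (hκ : ℵ₀ ≤ κ) (hC : catCard C ≤ κ) : IsFiltered (PureSub A κ) := by
  have : Nonempty (PureSub A κ) :=
    ⟨(exists_pureSub hκ hC (SubPsh.gen ∅) (SubPsh.pshCard_gen_le hκ hC (by simp))).choose⟩
  have : IsDirectedOrder (PureSub A κ) := ⟨fun P Q => by
    obtain ⟨R, hR, h₁, h₂⟩ :=
      SubPsh.exists_upper_bound₂ hκ hC P.sub Q.sub P.pshCard_le Q.pshCard_le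
    obtain ⟨R', hR'⟩ := exists_pureSub hκ hC R hR
    exact ⟨R', h₁.trans hR', h₂.trans hR'⟩⟩
  infer_instance

/-- Each section lies in a small pure subcoalgebra, so A is the directed union of them as a
presheaf. The underlying functor preserves colimits and reflects isomorphisms, so it reflects this
colimit. -/
lemma nonempty_isColimit_cocone (hκ : ℵ₀ ≤ κ) (hC : catCard C ≤ κ) :
    Nonempty (IsColimit (cocone A κ)) := by
  have := isFiltered (A := A) hκ hC
  obtain ⟨h⟩ : Nonempty (IsColimit ((underlying k C).mapCocone (cocone A κ))) := by
    refine nonempty_isColimit_of_injective _ (fun P => P.sub.incl_injective) fun X s => ?_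
    obtain ⟨P, hP⟩ := exists_pureSub hκ hC (SubPsh.gen {⟨X, s⟩})
      (SubPsh.pshCard_gen_le hκ hC (by
        rw [mk_singleton]
        exact one_le_aleph0.trans hκ))
    exact ⟨P, ⟨s, hP X (SubPsh.mem_gen rfl)⟩, rfl⟩
  have : ReflectsColimitsOfShape (PureSub A κ) (underlying k C) :=
    reflectsColimitsOfShape_of_reflectsIsomorphisms
  exact ⟨isColimitOfReflects (underlying k C) h⟩

end PureSub

end SmallSubcoalgebras

/-! ### Strong generation, the right adjoint and local presentability -/

lemma exists_colimitsOfShape_smallCoalgebras (A : CoCAlg k C) :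
    ∃ (J : Type u) (_ : SmallCategory J), (smallCoalgebras k C).colimitsOfShape J A := by
  obtain ⟨h⟩ := PureSub.nonempty_isColimit_cocone (A := A) (κ := max (catCard C) ℵ₀)
    (le_max_right _ _) (le_max_left _ _)
  exact ⟨_, _, ⟨⟨_, _, h⟩, fun P => P.pshCard_le⟩⟩

lemma isStrongGenerator_smallCoalgebras : (smallCoalgebras k C).IsStrongGenerator :=
  .mk_of_exists_colimitsOfShape exists_colimitsOfShape_smallCoalgebras

variable (k C) in
-- The adjoint functor theorem and the criterion for local presentability call for an actual set of
-- generators, so the class of small coalgebras is replaced by a set of representatives.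
lemma exists_small_isStrongGenerator : ∃ (Q : ObjectProperty (CoCAlg k C))
    (_ : ObjectProperty.Small.{u} Q), Q.IsStrongGenerator := by
  obtain ⟨Q, _, hQ⟩ := (essentiallySmall_smallCoalgebras (k := k) (C := C)).exists_small_le'
  refine ⟨Q, inferInstance, .mk_of_exists_colimitsOfShape fun A => ?_⟩
  obtain ⟨J, _, hJ⟩ := exists_colimitsOfShape_smallCoalgebras A
  refine ⟨J, inferInstance, ?_⟩
  rw [← ObjectProperty.colimitsOfShape_isoClosure]
  exact ObjectProperty.colimitsOfShape_monotone J hQ _ hJ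

instance : HasColimitsOfSize.{u, u} (CoCAlg k C) where
  has_colimits_of_shape _ _ := inferInstance

instance : PreservesColimitsOfSize.{u, u} (underlying k C) where
  preservesColimitsOfShape := inferInstance

instance isLeftAdjoint_underlying : (underlying k C).IsLeftAdjoint := by
  obtain ⟨Q, _, hQ⟩ := exists_small_isStrongGenerator k C
  -- The special adjoint functor theorem: the source is cocomplete and well-copowered with a small
  -- separating set.
  exact isLeftAdjoint_of_preservesColimits_of_isSeparating hQ.isSeparating _

instance isLocallyPresentable_coCAlg : IsLocallyPresentable.{u} (CoCAlg k C) where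
  exists_cardinal := by
    obtain ⟨Q, _, hQ⟩ := exists_small_isStrongGenerator k C
    have : IsLocallyPresentable.{u} (LinPsh k C) :=
      ⟨_, Cardinal.fact_isRegular_aleph0, isCardinalLocallyPresentable_linPsh⟩
    choose μ hμ hμ' using fun q : Shrink.{u} (Subtype Q) =>
      (inferInstance : IsPresentable.{u} ((equivShrink _).symm q).1.X).exists_cardinal
    -- Each underlying presheaf is presentable for its own cardinal μ q. The type `(μ q).ord.ToType`
    -- only serves as a set of that cardinality, and κ is regular above all of them.
    obtain ⟨κ, hκ, h⟩ := HasCardinalLT.exists_regular_cardinal_forall.{u}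
      fun q => (μ q).ord.ToType
    have : Fact κ.IsRegular := ⟨hκ⟩
    refine ⟨κ, this, (IsCardinalLocallyPresentable.iff_exists_isStrongGenerator _ _).2
      ⟨Q, inferInstance, hQ, fun A hA => ?_⟩⟩
    have hA' : IsCardinalPresentable A.X κ := by
      have h₁ := h (equivShrink _ ⟨A, hA⟩)
      have h₂ := hμ' (equivShrink _ ⟨A, hA⟩)
      rw [Equiv.symm_apply_apply] at h₂
      exact isCardinalPresentable_of_le _
        (le_of_lt (by simpa [hasCardinalLT_iff_cardinal_mk_lt] using h₁))
    exact CommComonoid.isCardinalPresentable κ A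

end Coalgebras

end DayCoalg

end

theorem theorem1p3 (k : Type u) [Field k] (C : Type u) [SmallCategory C] [Preadditive C]
    [Linear k C] [MonoidalCategory C] [MonoidalPreadditive C] [MonoidalLinear k C]
    [SymmetricCategory C] :
    IsLocallyPresentable.{u} (DayCoalg.CoCAlg k C) ∧
    ObjectProperty.EssentiallySmall.{u} (DayCoalg.smallCoalgebras k C) ∧
    (DayCoalg.smallCoalgebras k C).IsStrongGenerator ∧
    (DayCoalg.underlying k C).IsLeftAdjoint ∧
    Nonempty (ComonadicLeftAdjoint (DayCoalg.underlying k C)) :=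
  ⟨DayCoalg.isLocallyPresentable_coCAlg, DayCoalg.essentiallySmall_smallCoalgebras,
    DayCoalg.isStrongGenerator_smallCoalgebras, DayCoalg.isLeftAdjoint_underlying,
    CommComonoid.nonempty_comonadicLeftAdjoint (DayCoalg.LinPsh k C)⟩
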